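/- A positional scoring rule $r$ consists, for each number $m \ge 1$ of candidates, of natural numbers $r(m,1) \ge \dots \ge r(m,m)$, with $r(m,1) > r(m,m)$ whenever $m \ge 2$. It has polynomial scores if there is a polynomial $p$ with $r(m,j) \le p(m)$ for all $1 \le j \le m$. A partial profile on a set $C$ of $m$ candidates is a sequence $\mathbf{P} = (P_1,\dots,P_n)$ of partial orders on $C$; a completion of $\mathbf{P}$ is a sequence $\mathbf{T} = (T_1,\dots,T_n)$ of linear orders on $C$ such that $T_i$ extends $P_i$ for every $i$. In $\mathbf{T}$, a candidate $c$ has score $\sum_{i=1}^n r(m, j_i)$, where $j_i$ is the position of $c$ in $T_i$. Given a linear order on $C$, called the tiebreaker, the rank of $c$ in $\mathbf{T}$ is its position when the candidates are sorted by decreasing score, equal scores being ordered by the tiebreaker. The minimal rank of $c$ with respect to $\mathbf{P}$ is the smallest rank that $c$ attains in a completion of $\mathbf{P}$. Theorem. Let $r$ be a positional scoring rule with polynomial scores such that $r(m,j)$, for $1 \le j \le m$, is computable in time polynomial in $m$, and let $k \ge 1$ be a fixed integer. Then the following problem is solvable in polynomial time: given a partial profile on a set of $m$ candidates, a tiebreaker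 and a candidate $c$, decide whether the minimal rank of $c$ is smaller than $m-k+1$. -/

import Mathlib

/-- A positional scoring rule: for every number `m` of candidates a score vector
`score m 1 ≥ ⋯ ≥ score m m` of natural numbers, with `score m 1 > score m m` as soon as there are
at least two candidates. Values `score m j` with `j = 0` or `j > m` play no role. -/
structure PositionalScoringRule where
  score : ℕ → ℕ → ℕ
  antitone : ∀ m i j, 1 ≤ i → i ≤ j → j ≤ m → score m j ≤ score m i
  nontrivial : ∀ m, 2 ≤ m → score m m < score m 1

namespace PositionalScoringRule

/-- The scores are bounded by a polynomial in the number of candidates. -/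
def HasPolynomialScores (r : PositionalScoringRule) : Prop :=
  ∃ p : Polynomial ℕ, ∀ m j, 1 ≤ j → j ≤ m → r.score m j ≤ p.eval m

/-- `r.score m j`, for `1 ≤ j ≤ m`, is computable by a Turing machine in time polynomial in `m`
(`m` and `j` are given in unary, the score is written in binary). -/
def ComputableInPolyTime (r : PositionalScoringRule) : Prop :=
  Nonempty (Turing.TM2ComputableInPolyTime
    (fun q : {q : ℕ × ℕ // 1 ≤ q.2 ∧ q.2 ≤ q.1} =>
      (Computability.encodingProd Computability.unaryEncodingNat
        Computability.unaryEncodingNat).encode q.1)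
    Computability.encodeNat
    (fun q => r.score q.1.1 q.1.2))

end PositionalScoringRule

/-! ### Profiles, scores and ranks

The candidates are the elements of `Fin m`. A preference is a reflexive relation `R` on `Fin m`;
`R x y` says that `x` is equal or preferred to `y`. -/

/-- The position (counted from 1) of `c` in the linear order `R`. -/
noncomputable def position {m : ℕ} (R : Fin m → Fin m → Prop) (c : Fin m) : ℕ :=
  {x | R x c}.ncard

/-- The total score of `c` in the voting profile `T` of `n` voters. -/
noncomputable def totalScore (r : PositionalScoringRule) {m n : ℕ}
    (T : Fin n → Fin m → Fin m → Prop) (c : Fin m) : ℕ :=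
  ∑ i, r.score m (position (T i) c)

/-- The order that sorts the candidates by their scores in `T` and then by the tiebreaker. -/
def resultOrder (r : PositionalScoringRule) {m n : ℕ}
    (T : Fin n → Fin m → Fin m → Prop) (tie : Fin m → Fin m → Prop) (x y : Fin m) : Prop :=
  totalScore r T y < totalScore r T x ∨ (totalScore r T x = totalScore r T y ∧ tie x y)

/-- The rank of `c` in the voting profile `T` under the tiebreaker `tie`. -/
noncomputable def rank (r : PositionalScoringRule) {m n : ℕ}
    (T : Fin n → Fin m → Fin m → Prop) (tie : Fin m → Fin m → Prop) (c : Fin m) : ℕ :=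
  position (resultOrder r T tie) c

/-- `T` is a completion of `P`: every `T i` is a linear order that extends `P i`. -/
def IsCompletion {m n : ℕ} (T P : Fin n → Fin m → Fin m → Prop) : Prop :=
  ∀ i, IsLinearOrder (Fin m) (T i) ∧ ∀ x y, P i x y → T i x y

/-- The set of ranks that `c` gets in the completions of `P`. -/
def ranks (r : PositionalScoringRule) {m n : ℕ}
    (P : Fin n → Fin m → Fin m → Prop) (tie : Fin m → Fin m → Prop) (c : Fin m) : Set ℕ :=
  {k | ∃ T, IsCompletion T P ∧ rank r T tie c = k}

/-- The minimal rank that `c` gets in the completions of `P`. -/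
noncomputable def minRank (r : PositionalScoringRule) {m n : ℕ}
    (P : Fin n → Fin m → Fin m → Prop) (tie : Fin m → Fin m → Prop) (c : Fin m) : ℕ :=
  sInf (ranks r P tie c)

/-- A partial profile has completions, so the minimal rank is attained. -/
theorem minRank_mem (r : PositionalScoringRule) {m n : ℕ}
    (P : Fin n → Fin m → Fin m → Prop) (hP : ∀ i, IsPartialOrder (Fin m) (P i))
    (tie : Fin m → Fin m → Prop) (c : Fin m) :
    minRank r P tie c ∈ ranks r P tie c := by
  apply Nat.sInf_mem
  have h : ∀ i, ∃ s : Fin m → Fin m → Prop, IsLinearOrder (Fin m) s ∧ P i ≤ s := fun i => by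
    have := hP i
    exact extend_partialOrder (P i)
  choose T hT using h
  exact ⟨_, T, fun i => ⟨(hT i).1, fun x y hxy => (hT i).2 x y hxy⟩, rfl⟩

/-! ### The decision problem -/

/-- An input of the decision problem: `m` candidates, a partial profile of `n` voters, a
tiebreaker and a distinguished candidate. -/
structure RankInstance where
  m : ℕ
  n : ℕ
  profile : Fin n → Fin m → Fin m → Prop
  profile_partial : ∀ i, IsPartialOrder (Fin m) (profile i)
  tie : Fin m → Fin m → Prop
  tie_linear : IsLinearOrder (Fin m) tie
  c : Fin m

open Classical in
/-- A relation on `Fin m`, written as its `m × m` table of truth values, row by row, with a comma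
after each row and brackets around the table. -/
noncomputable def encodeRel {m : ℕ} (R : Fin m → Fin m → Prop) : List Computability.Γ' :=
  .bra :: ((List.finRange m).flatMap fun x =>
    ((List.finRange m).map fun y => .bit (decide (R x y))) ++ [.comma]) ++ [.ket]

/-- An instance as a string: the indicator vector of the distinguished candidate (of length `m`),
a comma, the tiebreaker, and the partial orders of the voters. -/
noncomputable def RankInstance.encode (I : RankInstance) : List Computability.Γ' :=
  ((List.finRange I.m).map fun x => .bit (decide (x = I.c))) ++ [.comma] ++
    encodeRel I.tie ++ (List.finRange I.n).flatMap fun i => encodeRel (I.profile i)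

open Classical in
/-- The decision problem `L`, whose inputs are given through the encoding `enc`, is solvable by a
(deterministic, multi-stack) Turing machine in time polynomial in the length of the encoded
input. -/
def SolvableInPolyTime {α Γ : Type} (enc : α → List Γ) (L : α → Prop) : Prop :=
  Nonempty (Turing.TM2ComputableInPolyTime enc Computability.encodeBool fun a => decide (L a))

/-- The decision problem whether the minimal rank is smaller than `m - k + 1`. -/
def MinRankBelowReversed (r : PositionalScoringRule) (k : ℕ) (I : RankInstance) : Prop :=
  (minRank r I.profile I.tie I.c : ℤ) < (I.m : ℤ) - k + 1

/-! In any ranking of the `m` candidates, the rank of `c` plus the number of candidates strictly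
behind `c` is `m`. Hence the minimal rank is below `m - k + 1` exactly when some completion puts at
least `k` candidates behind `c` (`minRankBelowReversed_iff`). Since `k` is fixed, there are only `m
^ (k + 1)` tuples consisting of `c` and `k` potential victims, and all of them can be tried.

For a fixed tuple, a completed vote matters only through the positions of these `k + 1` candidates,
so each voter has at most `m ^ (k + 1)` relevant choices. Two questions remain.

Which choices are possible for a voter? Prescribed positions turn into release times and deadlines
for all candidates: an element comes no earlier than the prescribed elements below it, and no later
than those above it. A linear extension is then a schedule of unit jobs with precedence constraints.
A Hall-type condition, that no interval has more jobs confined to it than slots, is clearly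
necessary. It is also sufficient, by greedy scheduling with earliest deadline first
(`exists_schedule`, `exists_linearExtension_iff`). The condition only requires counting.

Can the choices of the voters be combined so that `c` beats the others? Voters are independent and
only the `k + 1` total scores count. These are at most `n` times the top score, so polynomially many
score vectors occur, and dynamic programming over the voters decides which are attained (`Reach`,
`reach_succ`, `attains_iff`).

For the running time on an actual Turing machine, a small structured language of stack programs is
compiled to `TM2` machines (`Runs.steps`). Its subroutine call runs the given machine for the
scores. The functions `PT` computed by such programs in polynomial time are closed under
composition, branching and iteration with polynomially bounded intermediate results (`PT.comp`,
`PT.dite`, `PT.iterate`). This yields arithmetic, bounded quantifiers, counting and course-of-values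
recursion (`PD.bex`, `PT.card`, `PD.strongRec`). Numbers are unary throughout, so bounds on values
are bounds on sizes. The decision procedure is assembled from these closure properties and turned
into a machine by `PT.solvable`. -/

open Turing Computability

/-! ### Structured stack programs and their semantics -/

namespace StackProgram

variable (M : FinTM2)

/-- The stack alphabets: the registers are indexed by natural numbers, and the stacks of the
machine `M` are kept alongside. -/
def Alph : ℕ ⊕ M.K → Type
  | .inl _ => Γ'
  | .inr k => M.Γ k

/-- The contents of all stacks. -/
abbrev Store := ∀ k : ℕ ⊕ M.K, List (Alph M k)

/-- Structured programs on stacks, with a subroutine call of the machine `M`. -/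
inductive Cmd
  | skip
  | push (k : ℕ ⊕ M.K) (a : Alph M k)
  | pop (k : ℕ ⊕ M.K)
  | seq (p q : Cmd)
  | ite (k : ℕ ⊕ M.K) (P : Option (Alph M k) → Bool) (p q : Cmd)
  | loop (k : ℕ ⊕ M.K) (P : Option (Alph M k) → Bool) (p : Cmd)
  | call

variable {M}

namespace Cmd

/-- The labels that a program occupies in a Turing machine. -/
def Lab : Cmd M → Type
  | skip | push _ _ | pop _ => Unit
  | seq p q => p.Lab ⊕ q.Lab
  | ite _ _ p q => Option (p.Lab ⊕ q.Lab)
  | loop _ _ p => Option p.Lab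
  | call => M.Λ

instance fintypeLab : (p : Cmd M) → Fintype p.Lab
  | skip | push _ _ | pop _ => inferInstanceAs (Fintype Unit)
  | seq p q =>
    have := fintypeLab p
    have := fintypeLab q
    inferInstanceAs (Fintype (p.Lab ⊕ q.Lab))
  | ite _ _ p q =>
    have := fintypeLab p
    have := fintypeLab q
    inferInstanceAs (Fintype (Option (p.Lab ⊕ q.Lab)))
  | loop _ _ p =>
    have := fintypeLab p
    inferInstanceAs (Fintype (Option p.Lab))
  | call => M.ΛFin

/-- The label at which a program starts. -/
def entry : (p : Cmd M) → p.Lab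
  | skip | push _ _ | pop _ => ()
  | seq p _ => .inl p.entry
  | ite _ _ _ _ => none
  | loop _ _ _ => none
  | call => M.main

/-- The stacks that a program uses directly. -/
def keys : Cmd M → Finset (ℕ ⊕ M.K)
  | skip | call => ∅
  | push k _ | pop k => {k}
  | seq p q => p.keys ∪ q.keys
  | ite k _ p q => {k} ∪ (p.keys ∪ q.keys)
  | loop k _ p => {k} ∪ p.keys

end Cmd

/-- `Runs p s t s'`: started with the stacks `s`, the program `p` ends with the stacks `s'` after
`t` steps. -/
inductive Runs : Cmd M → Store M → ℕ → Store M → Prop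
  | skip (s) : Runs .skip s 1 s
  | push (k a s) : Runs (.push k a) s 1 (Function.update s k (a :: s k))
  | pop (k s) : Runs (.pop k) s 1 (Function.update s k (s k).tail)
  | seq {p q s t s' t' s''} (hp : Runs p s t s') (hq : Runs q s' t' s'') :
      Runs (.seq p q) s (t + t') s''
  | iteTrue {k P p q s t s'} (hP : P (s k).head? = true) (hp : Runs p s t s') :
      Runs (.ite k P p q) s (t + 1) s'
  | iteFalse {k P p q s t s'} (hP : P (s k).head? = false) (hq : Runs q s t s') :
      Runs (.ite k P p q) s (t + 1) s'
  | loopTrue {k P p s t s' t' s''} (hP : P (s k).head? = true) (hp : Runs p s t s')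
      (hl : Runs (.loop k P p) s' t' s'') : Runs (.loop k P p) s (t + t' + 1) s''
  | loopFalse {k P p s} (hP : P (s k).head? = false) : Runs (.loop k P p) s 1 s
  -- The machine has to return to its initial internal state, as `haltList` prescribes; this makes
  -- it callable repeatedly.
  | call {s s' : Store M} {t} (hr : ∀ r : ℕ, s' (.inl r) = s (.inl r))
      (h : (flip bind (TM2.step M.m))^[t]
        (some ⟨some M.main, M.initialState, fun k => s (.inr k)⟩) =
          some ⟨none, M.initialState, fun k => s' (.inr k)⟩) : Runs .call s t s'

/-! ### Compilation to a Turing machine -/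

section compile

variable {F : Finset (ℕ ⊕ M.K)} (hF : ∀ k : M.K, Sum.inr k ∈ F) {Λ : Type}

/-- The alphabets of the compiled machine, whose stacks are those in `F`. -/
abbrev TAlph (F : Finset (ℕ ⊕ M.K)) (k : F) : Type := Alph M k.1

/-- A statement of `M` as a statement of the compiled machine. -/
def liftStmt (emb : M.Λ → Λ) (exit : Λ) :
    TM2.Stmt M.Γ M.Λ M.σ → TM2.Stmt (TAlph F) Λ (Bool × M.σ)
  | .push k f q => .push ⟨.inr k, hF k⟩ (fun v => f v.2) (liftStmt emb exit q)
  | .peek k f q => .peek ⟨.inr k, hF k⟩ (fun v a => (v.1, f v.2 a)) (liftStmt emb exit q)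
  | .pop k f q => .pop ⟨.inr k, hF k⟩ (fun v a => (v.1, f v.2 a)) (liftStmt emb exit q)
  | .load f q => .load (fun v => (v.1, f v.2)) (liftStmt emb exit q)
  | .branch f p q => .branch (fun v => f v.2) (liftStmt emb exit p) (liftStmt emb exit q)
  | .goto f => .goto fun v => emb (f v.2)
  | .halt => .goto fun _ => exit

/-- The translation of a program, whose labels are embedded by `emb` into those of the compiled
machine and which jumps to `exit` at its end. -/
def compile : (p : Cmd M) → (p.Lab → Λ) → Λ → p.Lab → TM2.Stmt (TAlph F) Λ (Bool × M.σ)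
  | .skip, _, exit, _ => .goto fun _ => exit
  | .push k a, _, exit, _ =>
    -- A `FinTM2` has finitely many stacks, hence the restriction to `F`. The `halt` branches here
    -- and below are junk, never reached when `F` contains all keys of the program.
    if h : k ∈ F then .push ⟨k, h⟩ (fun _ => a) (.goto fun _ => exit) else .halt
  | .pop k, _, exit, _ =>
    if h : k ∈ F then .pop ⟨k, h⟩ (fun v _ => v) (.goto fun _ => exit) else .halt
  | .seq p q, emb, exit, l =>
    match (l : p.Lab ⊕ q.Lab) with
    | .inl l => compile p (fun l => emb (Sum.inl l : p.Lab ⊕ q.Lab))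
        (emb (Sum.inr q.entry : p.Lab ⊕ q.Lab)) l
    | .inr l => compile q (fun l => emb (Sum.inr l : p.Lab ⊕ q.Lab)) exit l
  | .ite k P p q, emb, exit, l =>
    match (l : Option (p.Lab ⊕ q.Lab)) with
    | none =>
      if h : k ∈ F then
        .peek ⟨k, h⟩ (fun v a => (P a, v.2)) (.branch (fun v => v.1)
          (.goto fun _ => emb (some (.inl p.entry) : Option (p.Lab ⊕ q.Lab)))
          (.goto fun _ => emb (some (.inr q.entry) : Option (p.Lab ⊕ q.Lab))))
      else .halt
    | some (.inl l) => compile p (fun l => emb (some (.inl l) : Option (p.Lab ⊕ q.Lab))) exit l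
    | some (.inr l) => compile q (fun l => emb (some (.inr l) : Option (p.Lab ⊕ q.Lab))) exit l
  | .loop k P p, emb, exit, l =>
    match (l : Option p.Lab) with
    | none =>
      if h : k ∈ F then
        .peek ⟨k, h⟩ (fun v a => (P a, v.2)) (.branch (fun v => v.1)
          (.goto fun _ => emb (some p.entry : Option p.Lab)) (.goto fun _ => exit))
      else .halt
    | some l => compile p (fun l => emb (some l : Option p.Lab)) (emb (none : Option p.Lab)) l
  | .call, emb, exit, l => liftStmt hF emb exit (M.m l)

/-- The stacks of the compiled machine. -/
def restrict (F : Finset (ℕ ⊕ M.K)) (s : Store M) (k : F) : List (TAlph F k) := s k.1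

theorem restrict_update (s : Store M) (k : ℕ ⊕ M.K) (h : k ∈ F) (v : List (Alph M k)) :
    restrict F (Function.update s k v) = Function.update (restrict F s) ⟨k, h⟩ v := by
  funext j
  by_cases hj : j = ⟨k, h⟩
  · subst hj
    simp [restrict]
  · have : j.1 ≠ k := fun e => hj (Subtype.ext e)
    simp [restrict, this, hj]

/-- Registers from `s`, stacks of `M` from `S`. -/
def combine (s : Store M) (S : ∀ k, List (M.Γ k)) : Store M
  | .inl r => s (.inl r)
  | .inr k => S k

theorem combine_update (s : Store M) (S : ∀ k, List (M.Γ k)) (k : M.K)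
    (v : List (Alph M (.inr k))) :
    Function.update (combine s S) (.inr k) v = combine s (Function.update S k v) := by
  funext j
  rcases j with r | j
  · exact Function.update_of_ne Sum.inl_ne_inr _ _
  · by_cases hj : j = k
    · subst hj
      exact (Function.update_self (β := fun k => List (Alph M k)) _ _ _).trans
        (Function.update_self (β := fun k => List (M.Γ k)) _ _ _).symm
    · exact (Function.update_of_ne (β := fun k => List (Alph M k))
          (fun e => hj (Sum.inr.inj e)) _ _).trans
        (Function.update_of_ne (β := fun k => List (M.Γ k)) hj _ _).symm

theorem restrict_combine_update (s : Store M) (S : ∀ k, List (M.Γ k)) (k : M.K)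
    (v : List (Alph M (.inr k))) :
    Function.update (restrict F (combine s S)) ⟨.inr k, hF k⟩ v =
      restrict F (combine s (Function.update S k v)) :=
  (restrict_update _ _ (hF k) _).symm.trans (congrArg (restrict F) (combine_update s S k v))

/-- A configuration of `M` inside the compiled machine. -/
def liftCfg (F : Finset (ℕ ⊕ M.K)) (emb : M.Λ → Λ) (exit : Λ) (s : Store M) (b : Bool)
    (c : TM2.Cfg M.Γ M.Λ M.σ) : TM2.Cfg (TAlph F) Λ (Bool × M.σ) where
  l := some (c.l.elim exit emb)
  var := (b, c.var)
  stk := restrict F (combine s c.stk)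

theorem stepAux_liftStmt (emb : M.Λ → Λ) (exit : Λ) (s : Store M) (b : Bool)
    (q : TM2.Stmt M.Γ M.Λ M.σ) (v : M.σ) (S : ∀ k, List (M.Γ k)) :
    TM2.stepAux (liftStmt hF emb exit q) (b, v) (restrict F (combine s S)) =
      liftCfg F emb exit s b (TM2.stepAux q v S) := by
  induction q generalizing v S with
  | push k f q ih =>
    exact (congrArg (TM2.stepAux (liftStmt hF emb exit q) (b, v))
      (restrict_combine_update hF s S k (f v :: S k))).trans (ih _ _)
  | peek k f q ih => exact ih _ _
  | pop k f q ih =>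
    exact (congrArg (TM2.stepAux (liftStmt hF emb exit q) (b, f v (S k).head?))
      (restrict_combine_update hF s S k (S k).tail)).trans (ih _ _)
  | load f q ih => exact ih _ _
  | branch f p q ihp ihq =>
    change cond (f v) _ _ = liftCfg F emb exit s b (cond (f v) _ _)
    cases f v
    · exact ihq _ _
    · exact ihp _ _
  | goto f => rfl
  | halt => rfl

/-- `Steps m n c c'`: the machine `m` goes from `c` to `c'` in `n` steps. -/
def Steps {K Λ σ : Type} {Γ : K → Type} [DecidableEq K] (m : Λ → TM2.Stmt Γ Λ σ) (n : ℕ)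
    (c c' : TM2.Cfg Γ Λ σ) : Prop :=
  (flip bind (TM2.step m))^[n] (some c) = some c'

theorem Steps.trans {K Λ σ : Type} {Γ : K → Type} [DecidableEq K] {m : Λ → TM2.Stmt Γ Λ σ}
    {n n' : ℕ} {c c' c'' : TM2.Cfg Γ Λ σ} (h : Steps m n c c') (h' : Steps m n' c' c'') :
    Steps m (n + n') c c'' := by
  unfold Steps at *
  rw [Nat.add_comm, Function.iterate_add_apply, h, h']

theorem Steps.of_step {K Λ σ : Type} {Γ : K → Type} [DecidableEq K] {m : Λ → TM2.Stmt Γ Λ σ}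
    {c c' : TM2.Cfg Γ Λ σ} (h : TM2.step m c = some c') : Steps m 1 c c' := h

theorem iterate_bind_none {α : Type} (f : α → Option α) (n : ℕ) :
    (flip bind f)^[n] none = none := by
  induction n with
  | zero => rfl
  | succ n ih => exact ih

/-- Halting of `M` is replaced by a jump to `exit`, so a halted configuration corresponds to one at
the label `exit` and the number of steps is unchanged. -/
theorem steps_liftCfg {m : Λ → TM2.Stmt (TAlph F) Λ (Bool × M.σ)} {emb : M.Λ → Λ} {exit : Λ}
    (hm : ∀ l, m (emb l) = liftStmt hF emb exit (M.m l)) (s : Store M) (b : Bool) {t : ℕ}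
    {c : TM2.Cfg M.Γ M.Λ M.σ} {v : M.σ} {S : ∀ k, List (M.Γ k)}
    (h : (flip bind (TM2.step M.m))^[t] (some c) = some ⟨none, v, S⟩) :
    Steps m t (liftCfg F emb exit s b c) (liftCfg F emb exit s b ⟨none, v, S⟩) := by
  induction t generalizing c with
  | zero =>
    cases h
    rfl
  | succ t ih =>
    rw [Function.iterate_succ_apply] at h
    rcases c with ⟨_ | l, w, S₀⟩
    · change (flip bind (TM2.step M.m))^[t] none = _ at h
      rw [iterate_bind_none] at h
      cases h
    · rw [Nat.add_comm]
      refine Steps.trans (Steps.of_step ?_) (ih h)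
      change some (TM2.stepAux (m (emb l)) _ _) = _
      rw [hm, stepAux_liftStmt]

/-- Correctness of the compiler, with exact time. The Boolean component of the state only holds the
result of the last test, so its initial and final values are left arbitrary. -/
theorem Runs.steps {p : Cmd M} {s s' : Store M} {t : ℕ} (h : Runs p s t s') (hp : p.keys ⊆ F)
    (m : Λ → TM2.Stmt (TAlph F) Λ (Bool × M.σ)) (emb : p.Lab → Λ) (exit : Λ)
    (hm : ∀ l, m (emb l) = compile hF p emb exit l) (b : Bool) :
    ∃ b', Steps m t ⟨some (emb p.entry), (b, M.initialState), restrict F s⟩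
      ⟨some exit, (b', M.initialState), restrict F s'⟩ := by
  induction h generalizing exit b with
  | skip s =>
    refine ⟨b, Steps.of_step ?_⟩
    rw [TM2.step, hm]
    rfl
  | push k a s =>
    have hk : k ∈ F := hp (by simp [Cmd.keys])
    refine ⟨b, Steps.of_step ?_⟩
    rw [TM2.step, hm, compile, dif_pos hk, restrict_update _ _ hk]
    rfl
  | pop k s =>
    have hk : k ∈ F := hp (by simp [Cmd.keys])
    refine ⟨b, Steps.of_step ?_⟩
    rw [TM2.step, hm, compile, dif_pos hk, restrict_update _ _ hk]
    rfl
  | @seq p q _ _ _ _ _ _ _ ihp ihq =>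
    simp only [Cmd.keys, Finset.union_subset_iff] at hp
    obtain ⟨b', h⟩ := ihp hp.1 (fun l => emb (Sum.inl l : p.Lab ⊕ q.Lab)) _
      (fun l => hm (Sum.inl l)) b
    obtain ⟨b'', h'⟩ := ihq hp.2 (fun l => emb (Sum.inr l : p.Lab ⊕ q.Lab)) exit
      (fun l => hm (Sum.inr l)) b'
    exact ⟨b'', h.trans h'⟩
  | @iteTrue k P p q s t s' hP _ ih =>
    simp only [Cmd.keys, Finset.union_subset_iff, Finset.singleton_subset_iff] at hp
    obtain ⟨b', h⟩ := ih hp.2.1 (fun l => emb (some (.inl l) : Option (p.Lab ⊕ q.Lab))) exit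
      (fun l => hm (some (.inl l))) true
    refine ⟨b', ?_⟩
    rw [Nat.add_comm]
    refine Steps.trans (Steps.of_step ?_) h
    rw [TM2.step, hm, Cmd.entry, compile]
    simp only [dif_pos hp.1, TM2.stepAux, restrict, hP, cond]
  | @iteFalse k P p q s t s' hP _ ih =>
    simp only [Cmd.keys, Finset.union_subset_iff, Finset.singleton_subset_iff] at hp
    obtain ⟨b', h⟩ := ih hp.2.2 (fun l => emb (some (.inr l) : Option (p.Lab ⊕ q.Lab))) exit
      (fun l => hm (some (.inr l))) false
    refine ⟨b', ?_⟩
    rw [Nat.add_comm]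
    refine Steps.trans (Steps.of_step ?_) h
    rw [TM2.step, hm, Cmd.entry, compile]
    simp only [dif_pos hp.1, TM2.stepAux, restrict, hP, cond]
  | @loopTrue k P p s t s' t' s'' hP _ _ ihp ihl =>
    have hp' := hp
    simp only [Cmd.keys, Finset.union_subset_iff, Finset.singleton_subset_iff] at hp
    obtain ⟨b', h⟩ := ihp hp.2 (fun l => emb (some l : Option p.Lab)) _
      (fun l => hm (some l)) true
    obtain ⟨b'', h'⟩ := ihl hp' emb exit hm b'
    refine ⟨b'', ?_⟩
    rw [Nat.add_comm]
    refine Steps.trans (Steps.of_step ?_) (h.trans h')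
    rw [TM2.step, hm, Cmd.entry, compile]
    simp only [dif_pos hp.1, TM2.stepAux, restrict, hP, cond]
  | @loopFalse k P p s hP =>
    simp only [Cmd.keys, Finset.union_subset_iff, Finset.singleton_subset_iff] at hp
    refine ⟨false, Steps.of_step ?_⟩
    rw [TM2.step, hm, Cmd.entry, compile]
    simp only [dif_pos hp.1, TM2.stepAux, restrict, hP, cond]
  | @call s s' t hr h =>
    refine ⟨b, ?_⟩
    have hs : restrict F s' = restrict F (combine s fun k => s' (.inr k)) := by
      congr 1
      funext j
      rcases j with r | k
      · exact hr r
      · rfl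
    have hs' : restrict F s = restrict F (combine s fun k => s (.inr k)) := by
      congr 1
      funext j
      rcases j with r | k <;> rfl
    rw [hs, hs']
    exact steps_liftCfg hF (emb := emb) (exit := exit) hm s b h

end compile

end StackProgram

namespace StackProgram

variable {M : FinTM2}

/-! ### Programs on registers -/

/-- The store with given registers, in which the stacks of `M` are empty. -/
def regs (M : FinTM2) (s : ℕ → List Γ') : Store M
  | .inl r => s r
  | .inr _ => []

theorem regs_update (s : ℕ → List Γ') (r : ℕ) (v : List Γ') :
    Function.update (regs M s) (.inl r) v = regs M (Function.update s r v) := by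
  funext j
  rcases j with j | j
  · by_cases hj : j = r
    · subst hj
      exact (Function.update_self (β := fun k => List (Alph M k)) _ _ _).trans
        (Function.update_self (β := fun _ => List Γ') _ _ _).symm
    · exact (Function.update_of_ne (β := fun k => List (Alph M k))
          (fun e => hj (Sum.inl.inj e)) _ _).trans
        (Function.update_of_ne (β := fun _ => List Γ') hj _ _).symm
  · exact Function.update_of_ne Sum.inr_ne_inl _ _

/-- The program `p` takes the registers `s` to the registers `s'` in at most `T` steps. -/
def RunsIn (p : Cmd M) (s : ℕ → List Γ') (T : ℕ) (s' : ℕ → List Γ') : Prop :=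
  ∃ t ≤ T, Runs p (regs M s) t (regs M s')

theorem RunsIn.mono {p : Cmd M} {s s' : ℕ → List Γ'} {T T' : ℕ} (h : RunsIn p s T s')
    (hT : T ≤ T') : RunsIn p s T' s' := by
  obtain ⟨t, ht, h⟩ := h
  exact ⟨t, ht.trans hT, h⟩

theorem RunsIn.seq {p q : Cmd M} {s s' s'' : ℕ → List Γ'} {T T' : ℕ} (h : RunsIn p s T s')
    (h' : RunsIn q s' T' s'') : RunsIn (.seq p q) s (T + T') s'' := by
  obtain ⟨t, ht, h⟩ := h
  obtain ⟨t', ht', h'⟩ := h'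
  exact ⟨t + t', by omega, .seq h h'⟩

theorem RunsIn.congr {p : Cmd M} {s s' s'' : ℕ → List Γ'} {T : ℕ} (h : RunsIn p s T s')
    (e : s' = s'') : RunsIn p s T s'' := e ▸ h

namespace Cmd

/-- Push a symbol on a register. -/
def rpush (r : ℕ) (a : Γ') : Cmd M := .push (.inl r) a

/-- Pop a symbol from a register. -/
def rpop (r : ℕ) : Cmd M := .pop (.inl r)

/-- Branch on the top of a register. -/
def rite (r : ℕ) (P : Option Γ' → Bool) (p q : Cmd M) : Cmd M := .ite (.inl r) P p q

/-- Repeat as long as a register is nonempty. -/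
def rloop (r : ℕ) (p : Cmd M) : Cmd M := .loop (.inl r) Option.isSome p

/-- Branch on the symbol at the top of a register. -/
def dispatch (r : ℕ) (f : Γ' → Cmd M) : Cmd M :=
  rite r (· == some .blank) (f .blank) <| rite r (· == some (.bit false)) (f (.bit false)) <|
    rite r (· == some (.bit true)) (f (.bit true)) <| rite r (· == some .bra) (f .bra) <|
      rite r (· == some .ket) (f .ket) (f .comma)

/-- Pop the symbols of a register one by one, and run a program for each. -/
def forEach (r : ℕ) (f : Γ' → Cmd M) : Cmd M :=
  rloop r (dispatch r fun a => .seq (rpop r) (f a))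

/-- Empty a block of registers. -/
def clear (r : ℕ) : ℕ → Cmd M
  | 0 => .skip
  | w + 1 => .seq (clear r w) (rloop (r + w) (rpop (r + w)))

/-- Copy a register. -/
def copyReg (x o n : ℕ) : Cmd M :=
  .seq (forEach x (rpush n)) (forEach n fun a => .seq (rpush x a) (rpush o a))

/-- Copy a block of registers. -/
def copy (i o n : ℕ) : ℕ → Cmd M
  | 0 => .skip
  | w + 1 => .seq (copy i o n w) (copyReg (i + w) (o + w) n)

/-- Push a word on a register. -/
def pushWord (r : ℕ) : List Γ' → Cmd M
  | [] => .skip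
  | a :: l => .seq (pushWord r l) (rpush r a)

/-- Push words on the registers of a block. -/
def pushWords (o : ℕ) (v : ℕ → List Γ') : ℕ → Cmd M
  | 0 => .skip
  | w + 1 => .seq (pushWords o v w) (pushWord (o + w) (v w))

end Cmd

open Cmd

theorem RunsIn.skip (s : ℕ → List Γ') : RunsIn (M := M) .skip s 1 s := ⟨1, le_rfl, .skip _⟩

theorem RunsIn.rpush (r : ℕ) (a : Γ') (s : ℕ → List Γ') :
    RunsIn (M := M) (rpush r a) s 1 (Function.update s r (a :: s r)) :=
  ⟨1, le_rfl, by rw [← regs_update]; exact .push _ _ _⟩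

theorem RunsIn.rpop (r : ℕ) (s : ℕ → List Γ') :
    RunsIn (M := M) (rpop r) s 1 (Function.update s r (s r).tail) :=
  ⟨1, le_rfl, by rw [← regs_update]; exact .pop _ _⟩

theorem RunsIn.riteTrue {r : ℕ} {P : Option Γ' → Bool} {p q : Cmd M} {s s' : ℕ → List Γ'} {T : ℕ}
    (hP : P (s r).head? = true) (h : RunsIn p s T s') : RunsIn (rite r P p q) s (T + 1) s' := by
  obtain ⟨t, ht, h⟩ := h
  exact ⟨t + 1, by omega, .iteTrue hP h⟩

theorem RunsIn.riteFalse {r : ℕ} {P : Option Γ' → Bool} {p q : Cmd M} {s s' : ℕ → List Γ'} {T : ℕ}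
    (hP : P (s r).head? = false) (h : RunsIn q s T s') : RunsIn (rite r P p q) s (T + 1) s' := by
  obtain ⟨t, ht, h⟩ := h
  exact ⟨t + 1, by omega, .iteFalse hP h⟩

theorem RunsIn.rloop_cons {r : ℕ} {p : Cmd M} {s s' s'' : ℕ → List Γ'} {T T' : ℕ}
    (hr : s r ≠ []) (h : RunsIn p s T s') (h' : RunsIn (rloop r p) s' T' s'') :
    RunsIn (rloop r p) s (T + T' + 1) s'' := by
  obtain ⟨t, ht, h⟩ := h
  obtain ⟨t', ht', h'⟩ := h'
  refine ⟨t + t' + 1, by omega, .loopTrue ?_ h h'⟩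
  change (s r).head?.isSome = true
  simpa using hr

theorem RunsIn.rloop_nil {r : ℕ} {p : Cmd M} {s : ℕ → List Γ'} (hr : s r = []) :
    RunsIn (rloop r p) s 1 s := by
  refine ⟨1, le_rfl, .loopFalse ?_⟩
  change (s r).head?.isSome = false
  simp [hr]

theorem RunsIn.dispatch {r : ℕ} {f : Γ' → Cmd M} {s s' : ℕ → List Γ'} {T : ℕ} {a : Γ'}
    {l : List Γ'} (hr : s r = a :: l) (h : RunsIn (f a) s T s') :
    RunsIn (dispatch r f) s (T + 5) s' := by
  unfold Cmd.dispatch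
  rcases a with _ | (_ | _) | _ | _ | _
  · exact (RunsIn.riteTrue (by simp [hr]) h).mono (by omega)
  · exact (RunsIn.riteFalse (by simp [hr]) (.riteTrue (by simp [hr]) h)).mono (by omega)
  · exact (RunsIn.riteFalse (by simp [hr]) (.riteFalse (by simp [hr])
      (.riteTrue (by simp [hr]) h))).mono (by omega)
  · exact (RunsIn.riteFalse (by simp [hr]) (.riteFalse (by simp [hr])
      (.riteFalse (by simp [hr]) (.riteTrue (by simp [hr]) h)))).mono (by omega)
  · exact (RunsIn.riteFalse (by simp [hr]) (.riteFalse (by simp [hr])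
      (.riteFalse (by simp [hr]) (.riteFalse (by simp [hr])
        (.riteTrue (by simp [hr]) h))))).mono (by omega)
  · exact (RunsIn.riteFalse (by simp [hr]) (.riteFalse (by simp [hr])
      (.riteFalse (by simp [hr]) (.riteFalse (by simp [hr])
        (.riteFalse (by simp [hr]) h))))).mono (by omega)

theorem RunsIn.forEach {x c : ℕ} {f : Γ' → Cmd M} (S : List Γ' → List Γ' → ℕ → List Γ')
    (hx : ∀ d r, S d r x = r)
    (hf : ∀ d a r, RunsIn (f a) (Function.update (S d (a :: r)) x r) c (S (d ++ [a]) r))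
    (d r : List Γ') : RunsIn (forEach x f) (S d r) ((c + 7) * r.length + 1) (S (d ++ r) []) := by
  induction r generalizing d with
  | nil => simpa [Cmd.forEach] using RunsIn.rloop_nil (hx d [])
  | cons a r ih =>
    have h1 := RunsIn.rpop (M := M) x (S d (a :: r))
    rw [hx, List.tail_cons] at h1
    have h2 := RunsIn.rloop_cons (r := x) (by simp [hx])
      (RunsIn.dispatch (f := fun a => .seq (Cmd.rpop x) (f a)) (hx d (a :: r)) (h1.seq (hf d a r)))
      (ih (d ++ [a]))
    rw [List.append_assoc, List.singleton_append] at h2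
    -- The cost per symbol is at most five tests in `dispatch`, one pop, `c` steps of the body and
    -- one loop test.
    refine h2.mono ?_
    rw [List.length_cons]
    linarith

/-- Overwrite the block of `w` registers that starts at `o`. -/
def put (s : ℕ → List Γ') (o w : ℕ) (v : ℕ → List Γ') (r : ℕ) : List Γ' :=
  if o ≤ r ∧ r < o + w then v (r - o) else s r

theorem put_zero (s : ℕ → List Γ') (o : ℕ) (v : ℕ → List Γ') : put s o 0 v = s := by
  funext r
  grind [put]

theorem put_succ (s : ℕ → List Γ') (o w : ℕ) (v : ℕ → List Γ') :
    put s o (w + 1) v = Function.update (put s o w v) (o + w) (v w) := by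
  funext r
  grind [put, Function.update_apply]

theorem put_add (s : ℕ → List Γ') (o w j : ℕ) (v : ℕ → List Γ') (hj : j < w) :
    put s o w v (o + j) = v j := by
  grind [put]

theorem put_of_notMem (s : ℕ → List Γ') (o w r : ℕ) (v : ℕ → List Γ') (hr : r < o ∨ o + w ≤ r) :
    put s o w v r = s r := by
  grind [put]

theorem RunsIn.clearReg (x : ℕ) (s : ℕ → List Γ') :
    RunsIn (M := M) (Cmd.rloop x (Cmd.rpop x)) s (2 * (s x).length + 1)
      (Function.update s x []) := by
  generalize hl : s x = l
  induction l generalizing s with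
  | nil => exact (RunsIn.rloop_nil hl).congr (by rw [← hl, Function.update_eq_self])
  | cons a l ih =>
    have h1 := RunsIn.rpop (M := M) x s
    rw [hl, List.tail_cons] at h1
    have h2 := RunsIn.rloop_cons (by simp [hl]) h1 (ih (Function.update s x l) (by simp))
    rw [Function.update_idem] at h2
    refine h2.mono ?_
    rw [List.length_cons]
    omega

theorem RunsIn.clear (x w : ℕ) (s : ℕ → List Γ') :
    RunsIn (M := M) (clear x w) s (2 * (∑ j ∈ Finset.range w, (s (x + j)).length) + w + 1)
      (put s x w fun _ => []) := by
  induction w with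
  | zero => exact (RunsIn.skip s).congr (put_zero _ _ _).symm
  | succ w ih =>
    rw [put_succ]
    refine (ih.seq (RunsIn.clearReg (x + w) _)).mono ?_
    rw [put_of_notMem _ _ _ _ _ (by omega), Finset.sum_range_succ]
    omega

/-- Moving a word between stacks reverses it, so it goes to the scratch register `n` and from there
back to both `x` and `o`. The two passes cost `1 + 7` and `2 + 7` per symbol. -/
theorem RunsIn.copyReg {x o n : ℕ} {s : ℕ → List Γ'} (hxo : x ≠ o) (hxn : x ≠ n) (hon : o ≠ n)
    (ho : s o = []) (hn : s n = []) :
    RunsIn (M := M) (copyReg x o n) s (17 * (s x).length + 2) (Function.update s o (s x)) := by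
  have h1 := RunsIn.forEach (M := M) (x := x) (c := 1) (f := Cmd.rpush n)
    (fun d r => Function.update (Function.update s x r) n d.reverse)
    (fun d r => by grind [Function.update_apply])
    (fun d a r => (RunsIn.rpush n a _).congr (by funext k; grind [Function.update_apply]))
    [] (s x)
  have h2 := RunsIn.forEach (M := M) (x := n) (c := 2)
    (f := fun a => .seq (Cmd.rpush x a) (Cmd.rpush o a))
    (fun d r => Function.update (Function.update (Function.update s n r) x d.reverse) o d.reverse)
    (fun d r => by grind [Function.update_apply])
    (fun d a r => ((RunsIn.rpush x a _).seq (RunsIn.rpush o a _)).congr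
      (by funext k; grind [Function.update_apply]))
    [] (s x).reverse
  have e0 : s = Function.update (Function.update s x (s x)) n [].reverse := by
    funext k
    grind [Function.update_apply]
  have e1 : Function.update (Function.update s x []) n ([] ++ s x).reverse =
      Function.update (Function.update (Function.update s n (s x).reverse) x [].reverse) o
        [].reverse := by
    funext k
    grind [Function.update_apply]
  rw [← e0, e1] at h1
  refine ((h1.seq h2).mono ?_).congr ?_
  · rw [List.length_reverse]
    omega
  · funext k
    grind [Function.update_apply]

theorem RunsIn.copy {i o n w : ℕ} {s : ℕ → List Γ'} (hi : i + w ≤ n) (ho : o + w ≤ n)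
    (hio : i + w ≤ o ∨ o + w ≤ i) (hs : ∀ j < w, s (o + j) = []) (hn : s n = []) :
    RunsIn (M := M) (copy i o n w) s
      (17 * (∑ j ∈ Finset.range w, (s (i + j)).length) + 2 * w + 1)
      (put s o w fun j => s (i + j)) := by
  induction w with
  | zero => exact (RunsIn.skip s).congr (put_zero _ _ _).symm
  | succ w ih =>
    have h1 := ih (by omega) (by omega) (by omega) (fun j hj => hs j (by omega))
    have h2 := RunsIn.copyReg (M := M) (x := i + w) (o := o + w) (n := n)
      (s := put s o w fun j => s (i + j)) (by omega) (by omega) (by omega)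
      (by rw [put_of_notMem _ _ _ _ _ (by omega), hs _ (by omega)])
      (by rw [put_of_notMem _ _ _ _ _ (by omega), hn])
    rw [put_of_notMem _ _ _ _ _ (by omega)] at h2
    rw [put_succ]
    refine (h1.seq h2).mono ?_
    rw [Finset.sum_range_succ]
    omega

theorem RunsIn.pushWord {r : ℕ} {l : List Γ'} {s : ℕ → List Γ'} (hr : s r = []) :
    RunsIn (M := M) (pushWord r l) s (l.length + 1) (Function.update s r l) := by
  induction l with
  | nil => exact (RunsIn.skip s).congr (by rw [← hr, Function.update_eq_self])
  | cons a l ih =>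
    have h := ih.seq (RunsIn.rpush r a _)
    rw [Function.update_self, Function.update_idem] at h
    refine h.mono ?_
    rw [List.length_cons]

theorem RunsIn.pushWords {o w : ℕ} {v : ℕ → List Γ'} {s : ℕ → List Γ'}
    (hs : ∀ j < w, s (o + j) = []) :
    RunsIn (M := M) (pushWords o v w) s ((∑ j ∈ Finset.range w, (v j).length) + w + 1)
      (put s o w v) := by
  induction w with
  | zero => exact (RunsIn.skip s).congr (put_zero _ _ _).symm
  | succ w ih =>
    rw [put_succ]
    refine ((ih fun j hj => hs j (by omega)).seq (RunsIn.pushWord ?_)).mono ?_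
    · rw [put_of_notMem _ _ _ _ _ (by omega), hs _ (by omega)]
    · rw [Finset.sum_range_succ]
      omega

end StackProgram

/-! ### Encodings in registers and closure properties of polynomial-time functions -/

namespace StackProgram

/-- Types whose elements are written in a fixed number of registers. -/
class Enc (α : Type) where
  /-- The number of registers. -/
  width : ℕ
  /-- The words in these registers. -/
  enc : α → ℕ → List Γ'

open Enc

/-- Unary notation makes the size of a number its value, so that loops bounded by a number are
polynomial. -/
instance : Enc ℕ := ⟨1, fun n _ => List.replicate n (.bit true)⟩

instance : Enc Bool := ⟨1, fun b _ => [.bit b]⟩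

instance : Enc (List Γ') := ⟨1, fun l _ => l⟩

instance {α β : Type} [Enc α] [Enc β] : Enc (α × β) :=
  ⟨width α + width β, fun x j => if j < width α then enc x.1 j else enc x.2 (j - width α)⟩

instance {α : Type} [Enc α] {p : α → Prop} : Enc {a // p a} := ⟨width α, fun a => enc a.1⟩

/-- The total length of the words that represent an element. -/
def size {α : Type} [Enc α] (a : α) : ℕ := ∑ j ∈ Finset.range (width α), (enc a j).length

variable {α β γ : Type} [Enc α] [Enc β] [Enc γ]

@[simp]
theorem size_nat (n : ℕ) : size n = n := by
  simp [size, width, enc]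

@[simp]
theorem size_bool (b : Bool) : size b = 1 := by
  simp [size, width, enc]

@[simp]
theorem size_list (l : List Γ') : size l = l.length := by
  simp [size, width, enc]

@[simp]
theorem size_pair (x : α × β) : size x = size x.1 + size x.2 := by
  unfold size
  change ∑ j ∈ Finset.range (width α + width β), _ = _
  rw [Finset.sum_range_add]
  congr 1
  · refine Finset.sum_congr rfl fun j hj => ?_
    simp [enc, Finset.mem_range.1 hj]
  · refine Finset.sum_congr rfl fun j hj => ?_
    simp [enc]

theorem eval_mono (p : Polynomial ℕ) {m n : ℕ} (h : m ≤ n) : p.eval m ≤ p.eval n := by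
  rw [Polynomial.eval_eq_sum, Polynomial.eval_eq_sum]
  exact Finset.sum_le_sum fun i _ => Nat.mul_le_mul_left _ (Nat.pow_le_pow_left h i)

/-- The program `P` computes `f` in time `T`: it reads its argument from the registers from `i` on,
writes the result to the registers from `o` on, and uses the registers from `n` on as scratch. -/
def Computes {M : FinTM2} (f : α → β) (P : ℕ → ℕ → ℕ → Cmd M) (T : Polynomial ℕ) : Prop :=
  ∀ i o n, i + width α ≤ n → o + width β ≤ n → (i + width α ≤ o ∨ o + width β ≤ i) →
    ∀ (a : α) (s : ℕ → List Γ'), (∀ j < width α, s (i + j) = enc a j) →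
      (∀ j < width β, s (o + j) = []) → (∀ r, n ≤ r → s r = []) →
        RunsIn (P i o n) s (T.eval (size a)) (put s o (width β) (enc (f a)))

/-- Functions computed in polynomial time by a program that may call the machine `M`, with results
of polynomial size. -/
def PT (M : FinTM2) (f : α → β) : Prop :=
  (∃ (P : ℕ → ℕ → ℕ → Cmd M) (T : Polynomial ℕ), Computes f P T) ∧
    ∃ B : Polynomial ℕ, ∀ a, size (f a) ≤ B.eval (size a)

variable {M : FinTM2}

theorem put_congr {s : ℕ → List Γ'} {o w : ℕ} {v v' : ℕ → List Γ'} (h : ∀ j < w, v j = v' j) :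
    put s o w v = put s o w v' := by
  funext r
  unfold put
  split_ifs with hr
  · exact h _ (by omega)
  · rfl

/-- Functions with the same encoded values are computed by the same programs. -/
theorem PT.recode {f : α → β} (hf : PT M f) {g : α → γ} (hw : width γ = width β)
    (h : ∀ a, ∀ j < width β, enc (g a) j = enc (f a) j) : PT M g := by
  obtain ⟨⟨P, T, hP⟩, B, hB⟩ := hf
  refine ⟨⟨P, T, fun i o n hi ho hio a s hs hs' hn => ?_⟩, B, fun a => ?_⟩
  · rw [hw] at ho hio hs' ⊢
    rw [put_congr (h a)]
    exact hP i o n hi ho hio a s hs hs' hn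
  · refine le_of_eq_of_le ?_ (hB a)
    unfold size
    rw [hw]
    exact Finset.sum_congr rfl fun j hj => by rw [h a j (Finset.mem_range.1 hj)]

/-- Precomposition with a map that does not change the encoding. -/
theorem PT.precode {f : β → γ} (hf : PT M f) (g : α → β) (hw : width α = width β)
    (h : ∀ a, ∀ j < width β, enc (g a) j = enc a j) : PT M fun a => f (g a) := by
  obtain ⟨⟨P, T, hP⟩, B, hB⟩ := hf
  have hsize (a) : size (g a) = size a := by
    unfold size
    rw [hw]
    exact Finset.sum_congr rfl fun j hj => by rw [h a j (Finset.mem_range.1 hj)]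
  refine ⟨⟨P, T, fun i o n hi ho hio a s hs hs' hn => ?_⟩, B, fun a => ?_⟩
  · rw [hw] at hi hio hs
    rw [← hsize]
    exact hP i o n hi ho hio (g a) s (fun j hj => by rw [hs j hj, h a j hj]) hs' hn
  · rw [← hsize]
    exact hB _

theorem sum_length_eq_size {s : ℕ → List Γ'} {i : ℕ} {a : α}
    (hs : ∀ j < width α, s (i + j) = enc a j) :
    ∑ j ∈ Finset.range (width α), (s (i + j)).length = size a :=
  Finset.sum_congr rfl fun j hj => by rw [hs j (Finset.mem_range.1 hj)]

theorem RunsIn.clear_enc {s : ℕ → List Γ'} {i : ℕ} {a : α}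
    (hs : ∀ j < width α, s (i + j) = enc a j) :
    RunsIn (M := M) (Cmd.clear i (width α)) s (2 * size a + width α + 1)
      (put s i (width α) fun _ => []) := by
  rw [← sum_length_eq_size hs]
  exact RunsIn.clear _ _ _

theorem RunsIn.copy_enc {s : ℕ → List Γ'} {i o n : ℕ} {a : α} (hi : i + width α ≤ n)
    (ho : o + width α ≤ n) (hio : i + width α ≤ o ∨ o + width α ≤ i)
    (hs : ∀ j < width α, s (i + j) = enc a j) (hs' : ∀ j < width α, s (o + j) = [])
    (hn : s n = []) :
    RunsIn (M := M) (Cmd.copy i o n (width α)) s (17 * size a + 2 * width α + 1)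
      (put s o (width α) (enc a)) := by
  rw [← sum_length_eq_size hs, ← put_congr hs]
  exact RunsIn.copy hi ho hio hs' hn

theorem PT.id : PT M fun a : α => a := by
  refine ⟨⟨fun i o n => .copy i o n (width α), 17 * .X + .C (2 * width α + 1), ?_⟩, .X, by simp⟩
  intro i o n hi ho hio a s hs hs' hn
  refine (RunsIn.copy_enc hi ho hio hs hs' (hn n le_rfl)).mono ?_
  simp

/-- The intermediate value lives in the first scratch registers and is erased at the end. The time
of the second program is polynomial in the size of `f a`, which is why `PT` also records a size
bound. -/
theorem PT.comp {g : β → γ} {f : α → β} (hg : PT M g) (hf : PT M f) : PT M fun a => g (f a) := by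
  obtain ⟨⟨P, T, hP⟩, B, hB⟩ := hf
  obtain ⟨⟨P', T', hP'⟩, B', hB'⟩ := hg
  refine ⟨⟨fun i o n => .seq (P i n (n + width β)) (.seq (P' n o (n + width β))
    (.clear n (width β))), T + (T'.comp B + (2 * B + .C (width β + 1))), ?_⟩, B'.comp B, ?_⟩
  · intro i o n hi ho hio a s hs hs' hn
    have h1 := hP i n (n + width β) (by omega) (by omega) (by omega) a s hs
      (fun j _ => hn _ (by omega)) (fun r hr => hn r (by omega))
    have h2 := hP' n o (n + width β) (by omega) (by omega) (by omega) (f a) _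
      (fun j hj => put_add s n _ j (enc (f a)) hj)
      (fun j hj => by rw [put_of_notMem _ _ _ _ _ (by omega), hs' j hj])
      (fun r hr => by rw [put_of_notMem _ _ _ _ _ (by omega), hn r (by omega)])
    have h3 := RunsIn.clear_enc (M := M) (i := n) (a := f a)
      (s := put (put s n (width β) (enc (f a))) o (width γ) (enc (g (f a))))
      (fun j hj => by rw [put_of_notMem _ _ _ _ _ (by omega), put_add _ _ _ _ _ hj])
    refine ((h1.seq (h2.seq h3)).mono ?_).congr ?_
    · have := eval_mono T' (hB a)
      have := hB a
      simp only [Polynomial.eval_add, Polynomial.eval_comp, Polynomial.eval_mul,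
        Polynomial.eval_C, Polynomial.eval_ofNat]
      omega
    · funext r
      have := hn r
      grind [put]
  · intro a
    rw [Polynomial.eval_comp]
    exact (hB' _).trans (eval_mono _ (hB a))

theorem PT.pair {f : α → β} {g : α → γ} (hf : PT M f) (hg : PT M g) :
    PT M fun a => (f a, g a) := by
  obtain ⟨⟨P, T, hP⟩, B, hB⟩ := hf
  obtain ⟨⟨P', T', hP'⟩, B', hB'⟩ := hg
  refine ⟨⟨fun i o n => .seq (P i o n) (P' i (o + width β) n), T + T', ?_⟩, B + B', ?_⟩
  · intro i o n hi ho hio a s hs hs' hn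
    change o + (width β + width γ) ≤ n at ho
    change i + width α ≤ o ∨ o + (width β + width γ) ≤ i at hio
    change ∀ j < width β + width γ, s (o + j) = [] at hs'
    have h1 := hP i o n hi (by omega) (by omega) a s hs (fun j hj => hs' j (by omega)) hn
    have h2 := hP' i (o + width β) n hi (by omega) (by omega) a
      (put s o (width β) (enc (f a)))
      (fun j hj => by rw [put_of_notMem _ _ _ _ _ (by omega), hs j hj])
      (fun j hj => by
        rw [put_of_notMem _ _ _ _ _ (by omega), Nat.add_assoc, hs' _ (by omega)])
      (fun r hr => by rw [put_of_notMem _ _ _ _ _ (by omega), hn r (by omega)])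
    refine ((h1.seq h2).mono (by rw [Polynomial.eval_add])).congr ?_
    funext r
    change _ = put s o (width β + width γ) (fun j =>
      if j < width β then enc (f a) j else enc (g a) (j - width β)) r
    grind [put]
  · intro a
    rw [size_pair, Polynomial.eval_add]
    exact Nat.add_le_add (hB a) (hB' a)

theorem PT.fst : PT M fun x : α × β => x.1 := by
  refine ⟨⟨fun i o n => .copy i o n (width α), 17 * .X + .C (2 * width α + 1), ?_⟩, .X, ?_⟩
  · intro i o n hi ho hio a s hs hs' hn
    change i + (width α + width β) ≤ n at hi
    change i + (width α + width β) ≤ o ∨ o + width α ≤ i at hio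
    refine (RunsIn.copy_enc (a := a.1) (by omega) ho (by omega) (fun j hj => ?_) hs'
      (hn n le_rfl)).mono ?_
    · exact (hs j (Nat.lt_add_right _ hj)).trans (if_pos hj)
    · simp
      omega
  · intro a
    simp

theorem PT.snd : PT M fun x : α × β => x.2 := by
  refine ⟨⟨fun i o n => .copy (i + width α) o n (width β), 17 * .X + .C (2 * width β + 1), ?_⟩,
    .X, ?_⟩
  · intro i o n hi ho hio a s hs hs' hn
    change i + (width α + width β) ≤ n at hi
    change i + (width α + width β) ≤ o ∨ o + width β ≤ i at hio
    refine (RunsIn.copy_enc (a := a.2) (by omega) ho (by omega) (fun j hj => ?_) hs'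
      (hn n le_rfl)).mono ?_
    · rw [Nat.add_assoc]
      refine (hs (width α + j) (Nat.add_lt_add_left hj _)).trans ?_
      refine (if_neg (by omega)).trans ?_
      rw [Nat.add_sub_cancel_left]
    · simp
      omega
  · intro a
    simp

theorem PT.const (b : β) : PT M fun _ : α => b := by
  refine ⟨⟨fun i o n => .pushWords o (enc b) (width β), .C (size b + width β + 1), ?_⟩,
    .C (size b), by simp⟩
  intro i o n hi ho hio a s hs hs' hn
  rw [Polynomial.eval_C]
  exact RunsIn.pushWords hs'

/-- Each branch is required to be computable only on the inputs that reach it. This is needed for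
the score machine, which is specified only for valid positions. -/
theorem PT.dite {c : α → Bool} (hc : PT M c) {f : {a // c a = true} → β}
    {g : {a // c a = false} → β} (hf : PT M f) (hg : PT M g) {F : α → β}
    (hFt : ∀ a, F a.1 = f a) (hFf : ∀ a, F a.1 = g a) : PT M F := by
  obtain ⟨⟨P, T, hP⟩, B, hB⟩ := hf
  obtain ⟨⟨P', T', hP'⟩, B', hB'⟩ := hg
  obtain ⟨⟨Pc, Tc, hPc⟩, -⟩ := hc
  refine ⟨⟨fun i o n => .seq (Pc i n (n + 1)) (.rite n (· == some (.bit true))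
    (.seq (.rpop n) (P i o n)) (.seq (.rpop n) (P' i o n))), Tc + T + T' + 2, ?_⟩, B + B', ?_⟩
  · intro i o n hi ho hio a s hs hs' hn
    have h1 := hPc i n (n + 1) (by omega) le_rfl (by omega) a s hs
      (fun j _ => hn _ (by omega)) (fun r hr => hn r (by omega))
    have htop : put s n (width Bool) (enc (c a)) n = [.bit (c a)] :=
      put_add s n 1 0 _ Nat.one_pos
    have h2 : RunsIn (M := M) (Cmd.rpop n) (put s n (width Bool) (enc (c a))) 1 s := by
      refine (RunsIn.rpop n _).congr ?_
      rw [htop]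
      funext r
      have := hn r
      change Function.update (put s n 1 _) n _ r = _
      grind [put, Function.update_apply]
    simp only [Polynomial.eval_add, Polynomial.eval_ofNat]
    cases hca : c a
    · rw [hca] at htop h1 h2
      have h3 := hP' i o n hi ho hio ⟨a, hca⟩ s hs hs' hn
      rw [← hFf ⟨a, hca⟩] at h3
      refine (h1.seq (.riteFalse (by rw [htop]; rfl) (h2.seq h3))).mono ?_
      change _ + (1 + T'.eval (size a) + 1) ≤ _
      omega
    · rw [hca] at htop h1 h2
      have h3 := hP i o n hi ho hio ⟨a, hca⟩ s hs hs' hn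
      rw [← hFt ⟨a, hca⟩] at h3
      refine (h1.seq (.riteTrue (by rw [htop]; rfl) (h2.seq h3))).mono ?_
      change _ + (1 + T.eval (size a) + 1) ≤ _
      omega
  · intro a
    rw [Polynomial.eval_add]
    cases hca : c a
    · rw [hFf ⟨a, hca⟩]
      exact (hB' ⟨a, hca⟩).trans (Nat.le_add_left _ _)
    · rw [hFt ⟨a, hca⟩]
      exact (hB ⟨a, hca⟩).trans (Nat.le_add_right _ _)

theorem PT.val {p : α → Prop} {f : α → β} (hf : PT M f) : PT M fun a : {a // p a} => f a.1 :=
  hf.precode _ rfl fun _ _ _ => rfl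

theorem PT.cond {c : α → Bool} {f g : α → β} (hc : PT M c) (hf : PT M f) (hg : PT M g) :
    PT M fun a => bif c a then f a else g a :=
  hc.dite hf.val hg.val (fun a => by rw [a.2]; rfl) (fun a => by rw [a.2]; rfl)

/-- Bounded iteration. -/
theorem PT.iterate {N : α → ℕ} {init : α → β} {step : α × β → β} (hN : PT M N)
    (hinit : PT M init) (hstep : PT M step) (B : Polynomial ℕ)
    (hB : ∀ a, ∀ t ≤ N a, size ((fun b => step (a, b))^[t] (init a)) ≤ B.eval (size a)) :
    PT M fun a => (fun b => step (a, b))^[N a] (init a) := by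
  obtain ⟨⟨PN, TN, hPN⟩, BN, hBN⟩ := hN
  obtain ⟨⟨Pi, Ti, hPi⟩, -⟩ := hinit
  obtain ⟨⟨Ps, Ts, hPs⟩, -⟩ := hstep
  -- Scratch layout: the counter at `n`, then a copy of `a`, the current value, and the next value.
  -- The copy of `a` and the current value are adjacent, so together they encode the pair that
  -- `step` reads.
  let u := width α
  let w := width β
  -- Cost of one round: `step` on an argument of size at most `size a + B`, then erasing the old
  -- value, copying the new one over and erasing its source, with `21 = 2 + 17 + 2`.
  let S : Polynomial ℕ := Ts.comp (.X + B) + 21 * B + .C (4 * w + 5)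
  refine ⟨⟨fun i o n =>
    .seq (PN i n (n + 1 + u + w + w)) <| .seq (.copy i (n + 1) (n + 1 + u + w + w) u) <|
    .seq (Pi i (n + 1 + u) (n + 1 + u + w + w)) <|
    .seq (.rloop n (.seq (.rpop n) <| .seq (Ps (n + 1) (n + 1 + u + w) (n + 1 + u + w + w)) <|
      .seq (.clear (n + 1 + u) w) <|
      .seq (.copy (n + 1 + u + w) (n + 1 + u) (n + 1 + u + w + w) w)
        (.clear (n + 1 + u + w) w))) <|
    .seq (.copy (n + 1 + u) o (n + 1 + u + w + w) w) <|
    .seq (.clear (n + 1) u) (.clear (n + 1 + u) w),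
    TN + Ti + BN * S + 19 * .X + 19 * B + .C (3 * u + 3 * w + 6), ?_⟩, B, fun a => hB a _ le_rfl⟩
  intro i o n hi ho hio a s hs hs' hn
  let st (c : ℕ) (b : β) : ℕ → List Γ' :=
    put (put (put s n 1 (enc c)) (n + 1) u (enc a)) (n + 1 + u) w (enc b)
  have hst (c : ℕ) (b : β) (r : ℕ) : st c b r =
      if n + 1 + u ≤ r ∧ r < n + 1 + u + w then enc b (r - (n + 1 + u)) else
      if n + 1 ≤ r ∧ r < n + 1 + u then enc a (r - (n + 1)) else
      if n = r then List.replicate c (.bit true) else s r := by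
    simp only [st, put]
    refine if_congr Iff.rfl rfl (if_congr Iff.rfl rfl (if_congr ?_ rfl rfl))
    omega
  have hstn (c : ℕ) (b : β) : st c b n = List.replicate c (.bit true) := by
    rw [hst, if_neg (by omega), if_neg (by omega), if_pos rfl]
  have hloop (c : ℕ) : ∀ t, t + c = N a →
      RunsIn (M := M) (.rloop n (.seq (.rpop n) <|
        .seq (Ps (n + 1) (n + 1 + u + w) (n + 1 + u + w + w)) <|
        .seq (.clear (n + 1 + u) w) <|
        .seq (.copy (n + 1 + u + w) (n + 1 + u) (n + 1 + u + w + w) w)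
          (.clear (n + 1 + u + w) w)))
        (st c ((fun b => step (a, b))^[t] (init a))) (c * S.eval (size a) + 1)
        (st 0 ((fun b => step (a, b))^[N a] (init a))) := by
    induction c with
    | zero =>
      intro t ht
      have : t = N a := ht
      subst this
      exact (RunsIn.rloop_nil (by simp [hstn])).mono (by omega)
    | succ c ih =>
      intro t ht
      have ih' := ih (t + 1) (by omega)
      have hb := hB a t (by omega)
      have hb' := hB a (t + 1) (by omega)
      rw [Function.iterate_succ_apply'] at ih' hb'
      generalize (fun b => step (a, b))^[t] (init a) = b at ih' hb hb' ⊢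
      generalize hy : step (a, b) = b' at ih' hb'
      have h1 : RunsIn (M := M) (Cmd.rpop n) (st (c + 1) b) 1 (st c b) := by
        refine (RunsIn.rpop n _).congr ?_
        funext r
        rw [Function.update_apply]
        simp only [hst]
        split_ifs <;> first | rfl | omega
      have h2 := hPs (n + 1) (n + 1 + u + w) (n + 1 + u + w + w)
        (by change n + 1 + (u + w) ≤ _; omega) le_rfl
        (Or.inl (by change n + 1 + (u + w) ≤ _; omega)) (a, b) (st c b)
        (fun j hj => by
          change j < u + w at hj
          change _ = if j < u then enc a j else enc b (j - u)
          rw [hst]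
          grind)
        (fun j hj => by
          change j < w at hj
          have := hn (n + 1 + u + w + j) (by omega)
          rw [hst]
          grind)
        (fun r hr => by
          have := hn r (by omega)
          rw [hst]
          grind)
      rw [hy] at h2
      have h3 := RunsIn.clear_enc (M := M) (i := n + 1 + u) (a := b)
        (s := put (st c b) (n + 1 + u + w) w (enc b'))
        (fun j hj => by
          change j < w at hj
          rw [put_of_notMem _ _ _ _ _ (by omega)]
          exact put_add _ _ _ _ _ hj)
      have h4 := RunsIn.copy_enc (M := M) (i := n + 1 + u + w) (o := n + 1 + u)
        (n := n + 1 + u + w + w) (a := b')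
        (s := put (put (st c b) (n + 1 + u + w) w (enc b')) (n + 1 + u) w fun _ => [])
        le_rfl (by change n + 1 + u + w ≤ _; omega) (Or.inr (by change n + 1 + u + w ≤ _; omega))
        (fun j hj => by
          change j < w at hj
          rw [put_of_notMem _ _ _ _ _ (by omega), put_add _ _ _ _ _ hj])
        (fun j hj => put_add _ _ _ _ _ hj)
        (by
          have := hn (n + 1 + u + w + w) (by omega)
          rw [put_of_notMem _ _ _ _ _ (by omega), put_of_notMem _ _ _ _ _ (by omega), hst]
          grind)
      have h5 := RunsIn.clear_enc (M := M) (i := n + 1 + u + w) (a := b')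
        (s := put (put (put (st c b) (n + 1 + u + w) w (enc b')) (n + 1 + u) w fun _ => [])
          (n + 1 + u) w (enc b'))
        (fun j hj => by
          change j < w at hj
          rw [put_of_notMem _ _ _ _ _ (by omega), put_of_notMem _ _ _ _ _ (by omega),
            put_add _ _ _ _ _ hj])
      have e : put (put (put (put (st c b) (n + 1 + u + w) w (enc b')) (n + 1 + u) w fun _ => [])
          (n + 1 + u) w (enc b')) (n + 1 + u + w) w (fun _ => []) = st c b' := by
        funext r
        have := hn r
        simp only [put, hst]
        grind
      refine (RunsIn.rloop_cons ?_ (h1.seq (h2.seq (h3.seq (h4.seq (h5.congr e))))) ih').mono ?_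
      · simp [hstn]
      · have := eval_mono Ts (Nat.add_le_add_left hb (size a))
        simp only [S, Polynomial.eval_add, Polynomial.eval_comp, Polynomial.eval_mul,
          Polynomial.eval_C, Polynomial.eval_X, Polynomial.eval_ofNat, size_pair, add_mul,
          one_mul] at this ⊢
        change _ + (_ + (_ + w + 1 + (_ + 2 * w + 1 + (_ + w + 1)))) + _ + 1 ≤ _
        omega
  have hres := hB a _ le_rfl
  have h0 := hPN i n (n + 1 + u + w + w) (by omega) (by change n + 1 ≤ _; omega) (by omega) a s hs
    (fun j _ => hn _ (by omega)) (fun r hr => hn r (by omega))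
  have h1 := RunsIn.copy_enc (M := M) (i := i) (o := n + 1) (n := n + 1 + u + w + w) (a := a)
    (s := put s n 1 (enc (N a))) (by omega) (by change n + 1 + u ≤ _; omega) (by omega)
    (fun j hj => by rw [put_of_notMem _ _ _ _ _ (by omega), hs j hj])
    (fun j hj => by rw [put_of_notMem _ _ _ _ _ (by omega), hn _ (by omega)])
    (by rw [put_of_notMem _ _ _ _ _ (by omega), hn _ (by omega)])
  have h2 := hPi i (n + 1 + u) (n + 1 + u + w + w) (by omega) (by change n + 1 + u + w ≤ _; omega)
    (by omega) a (put (put s n 1 (enc (N a))) (n + 1) u (enc a))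
    (fun j hj => by
      rw [put_of_notMem _ _ _ _ _ (by omega), put_of_notMem _ _ _ _ _ (by omega), hs j hj])
    (fun j hj => by
      rw [put_of_notMem _ _ _ _ _ (by omega), put_of_notMem _ _ _ _ _ (by omega), hn _ (by omega)])
    (fun r hr => by
      rw [put_of_notMem _ _ _ _ _ (by omega), put_of_notMem _ _ _ _ _ (by omega), hn _ (by omega)])
  have h3 := hloop (N a) 0 (by omega)
  beta_reduce
  generalize (fun b => step (a, b))^[N a] (init a) = b at h3 hres ⊢
  have h4 := RunsIn.copy_enc (M := M) (i := n + 1 + u) (o := o) (n := n + 1 + u + w + w) (a := b)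
    (s := st 0 b) (by change n + 1 + u + w ≤ _; omega) (by omega) (by omega)
    (fun j hj => put_add _ _ _ _ _ hj)
    (fun j hj => by
      have := hs' j hj
      rw [hst]
      grind)
    (by
      have := hn (n + 1 + u + w + w) (by omega)
      rw [hst]
      grind)
  have h5 := RunsIn.clear_enc (M := M) (i := n + 1) (a := a) (s := put (st 0 b) o w (enc b))
    (fun j hj => by
      change j < u at hj
      rw [put_of_notMem _ _ _ _ _ (by omega), hst]
      grind)
  have h6 := RunsIn.clear_enc (M := M) (i := n + 1 + u) (a := b)
    (s := put (put (st 0 b) o w (enc b)) (n + 1) u fun _ => [])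
    (fun j hj => by
      change j < w at hj
      rw [put_of_notMem _ _ _ _ _ (by omega), put_of_notMem _ _ _ _ _ (by omega), hst]
      grind)
  refine ((h0.seq (h1.seq (h2.seq (h3.seq (h4.seq (h5.seq h6)))))).mono ?_).congr ?_
  · have hN' : N a ≤ BN.eval (size a) := by simpa using hBN a
    have := Nat.mul_le_mul_right (S.eval (size a)) hN'
    simp only [Polynomial.eval_add, Polynomial.eval_mul, Polynomial.eval_C, Polynomial.eval_X,
      Polynomial.eval_ofNat]
    change _ + (_ + 2 * u + 1 + (_ + (_ + (_ + 2 * w + 1 + (_ + u + 1 + (_ + w + 1)))))) ≤ _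
    omega
  · funext r
    have := hn r
    change put (put (put (st 0 b) o w (enc b)) (n + 1) u fun _ => []) (n + 1 + u) w (fun _ => []) r
      = put s o w (enc b) r
    simp only [put, hst]
    grind

end StackProgram

namespace StackProgram

open Enc

variable {α β γ : Type} [Enc α] [Enc β] [Enc γ] {M : FinTM2}

/-! ### Elementary functions -/

theorem PT.cons_const (c : Γ') : PT M fun l : List Γ' => c :: l := by
  refine ⟨⟨fun i o n => .seq (.copy i o n 1) (.rpush o c), 17 * .X + 4, ?_⟩, .X + 1, by simp⟩
  intro i o n hi ho hio a s hs hs' hn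
  have h := (RunsIn.copy_enc (M := M) hi ho hio hs hs' (hn n le_rfl)).seq (RunsIn.rpush o c _)
  refine (h.mono ?_).congr ?_
  · simp only [Polynomial.eval_add, Polynomial.eval_mul, Polynomial.eval_X, Polynomial.eval_ofNat]
    exact le_rfl
  · change Function.update (put s o 1 fun _ => a) o (c :: put s o 1 (fun _ => a) o) =
      put s o 1 fun _ => c :: a
    funext r
    grind [put, Function.update_apply]

theorem PT.tail : PT M fun l : List Γ' => l.tail := by
  refine ⟨⟨fun i o n => .seq (.copy i o n 1) (.rpop o), 17 * .X + 4, ?_⟩, .X, by simp⟩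
  intro i o n hi ho hio a s hs hs' hn
  have h := (RunsIn.copy_enc (M := M) hi ho hio hs hs' (hn n le_rfl)).seq (RunsIn.rpop o _)
  refine (h.mono ?_).congr ?_
  · simp only [Polynomial.eval_add, Polynomial.eval_mul, Polynomial.eval_X, Polynomial.eval_ofNat]
    exact le_rfl
  · change Function.update (put s o 1 fun _ => a) o (put s o 1 (fun _ => a) o).tail =
      put s o 1 fun _ => a.tail
    funext r
    grind [put, Function.update_apply]

theorem PT.testHead (P : Option Γ' → Bool) : PT M fun l : List Γ' => P l.head? := by
  refine ⟨⟨fun i o n => .rite i P (.rpush o (.bit true)) (.rpush o (.bit false)), 2, ?_⟩, 1,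
    by simp⟩
  intro i o n hi ho hio a s hs hs' hn
  have hi' : s i = a := hs 0 Nat.one_pos
  have ho' : s o = [] := hs' 0 Nat.one_pos
  have e (b : Bool) : Function.update s o (.bit b :: s o) = put s o 1 fun _ => [.bit b] := by
    funext r
    grind [put, Function.update_apply]
  rw [Polynomial.eval_ofNat]
  beta_reduce
  cases hP : P a.head?
  · exact (RunsIn.riteFalse (by rw [hi', hP]) (RunsIn.rpush o _ s)).congr (e false)
  · exact (RunsIn.riteTrue (by rw [hi', hP]) (RunsIn.rpush o _ s)).congr (e true)

theorem PT.length : PT M fun l : List Γ' => l.length := by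
  refine ⟨⟨fun i o n => .seq (.copy i n (n + 1) 1) (.forEach n fun _ => .rpush o (.bit true)),
    25 * .X + 4, ?_⟩, .X, by simp⟩
  intro i o n hi ho hio a s hs hs' hn
  change i + 1 ≤ n at hi
  change o + 1 ≤ n at ho
  have ho' : s o = [] := hs' 0 Nat.one_pos
  have h1 := RunsIn.copy_enc (M := M) (i := i) (o := n) (n := n + 1) (a := a) (s := s)
    (by change i + 1 ≤ _; omega) le_rfl (by change i + 1 ≤ _ ∨ _; omega) hs
    (fun j _ => hn _ (by omega)) (hn _ (by omega))
  have h2 := RunsIn.forEach (M := M) (x := n) (c := 1) (f := fun _ => .rpush o (.bit true))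
    (fun d r => Function.update (Function.update s n r) o (List.replicate d.length (.bit true)))
    (fun d r => by grind [Function.update_apply])
    (fun d a r => (RunsIn.rpush o _ _).congr
      (by
        have : List.replicate (d ++ [a]).length (Γ'.bit true) =
          .bit true :: List.replicate d.length (.bit true) := by simp [List.replicate_succ]
        rw [this]
        funext k
        grind [Function.update_apply])) [] a
  refine (((h1.congr ?_).seq h2).mono ?_).congr ?_
  · funext r
    change put s n 1 (fun _ => a) r = _
    grind [put, Function.update_apply]
  · simp only [Polynomial.eval_add, Polynomial.eval_mul, Polynomial.eval_X, Polynomial.eval_ofNat,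
      size_list]
    change _ + 2 * 1 + 1 + _ ≤ _
    omega
  · funext r
    have := hn n le_rfl
    change _ = put s o 1 (fun _ => List.replicate a.length (.bit true)) r
    grind [put, Function.update_apply]

theorem PT.replicate : PT M fun n : ℕ => List.replicate n (Γ'.bit true) :=
  PT.id.recode rfl fun _ _ _ => rfl

theorem PT.succ {f : α → ℕ} (hf : PT M f) : PT M fun a => f a + 1 :=
  ((PT.cons_const (.bit true)).comp (PT.replicate.comp hf)).recode rfl
    fun _ _ _ => List.replicate_succ

theorem PT.pred {f : α → ℕ} (hf : PT M f) : PT M fun a => f a - 1 :=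
  (PT.tail.comp (PT.replicate.comp hf)).recode rfl fun _ _ _ => List.tail_replicate.symm

theorem PT.add {f g : α → ℕ} (hf : PT M f) (hg : PT M g) : PT M fun a => f a + g a := by
  obtain ⟨Bf, hBf⟩ := hf.2
  obtain ⟨Bg, hBg⟩ := hg.2
  have e (a t : ℕ) : (fun b => b + 1)^[t] a = a + t := by
    induction t with
    | zero => rfl
    | succ t ih => rw [Function.iterate_succ_apply', ih, Nat.add_assoc]
  have h := PT.iterate (step := fun x : α × ℕ => x.2 + 1) hg hf PT.snd.succ (Bf + Bg)
    (fun a t ht => by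
      have := hBf a
      have := hBg a
      simp only [e, size_nat, Polynomial.eval_add] at *
      omega)
  simpa only [e] using h

theorem PT.mul {f g : α → ℕ} (hf : PT M f) (hg : PT M g) : PT M fun a => f a * g a := by
  obtain ⟨Bf, hBf⟩ := hf.2
  obtain ⟨Bg, hBg⟩ := hg.2
  have e (c t : ℕ) : (fun b => b + c)^[t] 0 = c * t := by
    induction t with
    | zero => rfl
    | succ t ih => rw [Function.iterate_succ_apply', ih, Nat.mul_succ]
  have h := PT.iterate (step := fun x : α × ℕ => x.2 + f x.1) hg (PT.const 0)
    (PT.snd.add (hf.comp PT.fst)) (Bf * Bg)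
    (fun a t ht => by
      have h1 := hBf a
      have h2 := hBg a
      simp only [e, size_nat, Polynomial.eval_mul] at *
      exact Nat.mul_le_mul h1 (ht.trans h2))
  simpa only [e] using h

theorem PT.sub {f g : α → ℕ} (hf : PT M f) (hg : PT M g) : PT M fun a => f a - g a := by
  obtain ⟨Bf, hBf⟩ := hf.2
  have e (a t : ℕ) : (fun b => b - 1)^[t] a = a - t := by
    induction t with
    | zero => rfl
    | succ t ih => rw [Function.iterate_succ_apply', ih, Nat.sub_sub]
  have h := PT.iterate (step := fun x : α × ℕ => x.2 - 1) hg hf PT.snd.pred Bf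
    (fun a t _ => by
      have := hBf a
      simp only [e, size_nat] at *
      omega)
  simpa only [e] using h

/-- The exponent is a constant of the program: in unary, a power with variable exponent need not
have polynomial size. -/
theorem PT.pow {f : α → ℕ} (hf : PT M f) (k : ℕ) : PT M fun a => f a ^ k := by
  induction k with
  | zero => exact PT.const 1
  | succ k ih => exact ih.mul hf

theorem PT.drop {l : α → List Γ'} {f : α → ℕ} (hl : PT M l) (hf : PT M f) :
    PT M fun a => (l a).drop (f a) := by
  obtain ⟨B, hB⟩ := hl.2
  have e (l : List Γ') (t : ℕ) : List.tail^[t] l = l.drop t := by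
    induction t with
    | zero => rfl
    | succ t ih => rw [Function.iterate_succ_apply', ih, List.tail_drop]
  have h := PT.iterate (step := fun x : α × List Γ' => x.2.tail) hf hl (PT.tail.comp PT.snd) B
    (fun a t _ => by
      have := hB a
      change size (List.tail^[t] (l a)) ≤ _
      rw [e]
      simp only [size_list, List.length_drop] at *
      omega)
  refine h.recode rfl fun a _ _ => ?_
  change (l a).drop (f a) = List.tail^[f a] (l a)
  rw [e]

/-! ### Decidable predicates -/

open Classical in
/-- Predicates that are decided in polynomial time. -/
def PD (M : FinTM2) (R : α → Prop) : Prop := PT M fun a => decide (R a)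

theorem PD.of_bool {R : α → Prop} {f : α → Bool} (hf : PT M f) (h : ∀ a, R a ↔ f a = true) :
    PD M R :=
  hf.recode rfl fun a _ _ => by simp only [h, Bool.decide_eq_true]

theorem PD.congr {R S : α → Prop} (hR : PD M R) (h : ∀ a, S a ↔ R a) : PD M S :=
  PD.of_bool hR fun a => by simp [h]

theorem PD.comp {R : β → Prop} (hR : PD M R) {f : α → β} (hf : PT M f) : PD M fun a => R (f a) :=
  PT.comp hR hf

theorem PD.const (p : Prop) : PD M fun _ : α => p := PT.const _

theorem PD.not {R : α → Prop} (hR : PD M R) : PD M fun a => ¬R a :=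
  PD.of_bool (PT.cond hR (PT.const false) (PT.const true)) fun a => by by_cases h : R a <;> simp [h]

theorem PD.and {R S : α → Prop} (hR : PD M R) (hS : PD M S) : PD M fun a => R a ∧ S a :=
  PD.of_bool (PT.cond hR hS (PT.const false)) fun a => by by_cases h : R a <;> simp [h]

theorem PD.or {R S : α → Prop} (hR : PD M R) (hS : PD M S) : PD M fun a => R a ∨ S a :=
  PD.of_bool (PT.cond hR (PT.const true) hS) fun a => by by_cases h : R a <;> simp [h]

theorem PD.imp {R S : α → Prop} (hR : PD M R) (hS : PD M S) : PD M fun a => R a → S a :=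
  (hR.not.or hS).congr fun _ => imp_iff_not_or

open Classical in
theorem PT.ite {R : α → Prop} (hR : PD M R) {f g : α → β} (hf : PT M f) (hg : PT M g) :
    PT M fun a => if R a then f a else g a :=
  (PT.cond hR hf hg).recode rfl fun a _ _ => by by_cases h : R a <;> simp [h]

theorem PD.eq_zero {f : α → ℕ} (hf : PT M f) : PD M fun a => f a = 0 :=
  PD.of_bool ((PT.testHead Option.isNone).comp (PT.replicate.comp hf)) fun a => by
    cases f a <;> simp [List.replicate_succ]

theorem PD.le {f g : α → ℕ} (hf : PT M f) (hg : PT M g) : PD M fun a => f a ≤ g a :=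
  (PD.eq_zero (hf.sub hg)).congr fun _ => Nat.sub_eq_zero_iff_le.symm

theorem PD.lt {f g : α → ℕ} (hf : PT M f) (hg : PT M g) : PD M fun a => f a < g a :=
  PD.le hf.succ hg

theorem PD.eq {f g : α → ℕ} (hf : PT M f) (hg : PT M g) : PD M fun a => f a = g a :=
  ((PD.le hf hg).and (PD.le hg hf)).congr fun _ => le_antisymm_iff

theorem PD.getElem {l : α → List Γ'} {f : α → ℕ} (hl : PT M l) (hf : PT M f) (c : Γ') :
    PD M fun a => (l a)[f a]? = some c :=
  PD.of_bool ((PT.testHead (· == some c)).comp (hl.drop hf)) fun a => by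
    simp [List.head?_drop]

/-- Exhaustive search: the loop carries a flag for success and the next index to try. Its length is
polynomial because `N a` has a polynomially bounded value. -/
theorem PD.bex {R : α → ℕ → Prop} {N : α → ℕ} (hR : PD M fun x : α × ℕ => R x.1 x.2)
    (hN : PT M N) : PD M fun a => ∃ i < N a, R a i := by
  classical
  obtain ⟨B, hB⟩ := hN.2
  let step (x : α × Bool × ℕ) : Bool × ℕ :=
    (bif x.2.1 then true else decide (R x.1 x.2.2), x.2.2 + 1)
  have hstep : PT M step := (PT.cond (PT.fst.comp PT.snd) (PT.const true)
    (hR.comp (PT.fst.pair (PT.snd.comp PT.snd)))).pair (PT.snd.comp PT.snd).succ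
  have e (a : α) (t : ℕ) :
      (fun b => step (a, b))^[t] (false, 0) = (decide (∃ i < t, R a i), t) := by
    induction t with
    | zero => simp
    | succ t ih =>
      rw [Function.iterate_succ_apply', ih]
      by_cases h : ∃ i < t, R a i
      · have h' : ∃ i < t + 1, R a i := h.imp fun i hi => ⟨by omega, hi.2⟩
        simp only [step, h, h', decide_true, cond]
      · have h' : (∃ i < t + 1, R a i) ↔ R a t := by
          refine ⟨fun ⟨i, hi, hR⟩ => ?_, fun h => ⟨t, by omega, h⟩⟩
          obtain rfl : i = t := by
            by_contra hne
            exact h ⟨i, by omega, hR⟩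
          exact hR
        simp only [step, h, h', decide_false, cond]
  have h := PT.iterate hN (PT.const (false, 0)) hstep (B + 1) (fun a t ht => by
    have := hB a
    simp only [e, size_nat, size_pair, size_bool, Polynomial.eval_add, Polynomial.eval_one] at *
    omega)
  simp only [e] at h
  exact PD.of_bool (PT.fst.comp h) fun a => by simp

theorem PD.ball {R : α → ℕ → Prop} {N : α → ℕ} (hR : PD M fun x : α × ℕ => R x.1 x.2)
    (hN : PT M N) : PD M fun a => ∀ i < N a, R a i :=
  (PD.bex (R := fun a i => ¬R a i) hR.not hN).not.congr fun a => by simp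

open Classical in
theorem PT.card {R : α → ℕ → Prop} {N : α → ℕ} (hR : PD M fun x : α × ℕ => R x.1 x.2)
    (hN : PT M N) : PT M fun a => ((Finset.range (N a)).filter (R a)).card := by
  obtain ⟨B, hB⟩ := hN.2
  let step (x : α × ℕ × ℕ) : ℕ × ℕ :=
    (if R x.1 x.2.2 then x.2.1 + 1 else x.2.1, x.2.2 + 1)
  have hstep : PT M step := (PT.ite (hR.comp (PT.fst.pair (PT.snd.comp PT.snd)))
    (PT.fst.comp PT.snd).succ (PT.fst.comp PT.snd)).pair (PT.snd.comp PT.snd).succ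
  have e (a : α) (t : ℕ) :
      (fun b => step (a, b))^[t] (0, 0) = (((Finset.range t).filter (R a)).card, t) := by
    induction t with
    | zero => simp
    | succ t ih =>
      rw [Function.iterate_succ_apply', ih, Finset.range_add_one, Finset.filter_insert]
      by_cases h : R a t <;> simp [step, h]
  have h := PT.iterate hN (PT.const (0, 0)) hstep (2 * B) (fun a t ht => by
    have := hB a
    have := (Finset.card_filter_le (Finset.range t) (R a))
    simp only [e, size_nat, size_pair, Finset.card_range, Polynomial.eval_mul,
      Polynomial.eval_ofNat] at *
    omega)
  simp only [e] at h
  exact PT.fst.comp h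

/-- The quotient is the number of positive multiples of `g a` up to `f a`. The guard `0 < g a` makes
the count agree with division by zero. -/
theorem PT.div {f g : α → ℕ} (hf : PT M f) (hg : PT M g) : PT M fun a => f a / g a := by
  classical
  refine (PT.card (R := fun a i => 0 < g a ∧ (i + 1) * g a ≤ f a) ((PD.lt (PT.const 0)
    (hg.comp PT.fst)).and (PD.le (PT.snd.succ.mul (hg.comp PT.fst)) (hf.comp PT.fst)))
    hf).recode rfl fun a _ _ => ?_
  congr 1
  rcases Nat.eq_zero_or_pos (g a) with h | h
  · simp [h]
  · refine (Finset.card_range _).symm.trans (congrArg Finset.card ?_)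
    ext i
    simp only [Finset.mem_filter, Finset.mem_range, h, true_and]
    rw [← Nat.le_div_iff_mul_le h]
    have := Nat.div_le_self (f a) (g a)
    omega

theorem PT.mod {f g : α → ℕ} (hf : PT M f) (hg : PT M g) : PT M fun a => f a % g a :=
  (hf.sub (hg.mul (hf.div hg))).recode rfl fun a _ _ => by rw [Nat.mod_eq_sub]

/-- The digits of a number. -/
theorem PT.digit {f b j : α → ℕ} (hf : PT M f) (hb : PT M b) (hj : PT M j) :
    PT M fun a => f a / b a ^ j a % b a := by
  obtain ⟨B, hB⟩ := hf.2
  -- Dividing repeatedly avoids the power `b ^ j`, which may be too large in unary; the quotients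
  -- never exceed the initial value.
  have e (x b t : ℕ) : (fun y => y / b)^[t] x = x / b ^ t := by
    induction t with
    | zero => simp
    | succ t ih => rw [Function.iterate_succ_apply', ih, Nat.div_div_eq_div_mul, pow_succ]
  have h := PT.iterate (step := fun x : α × ℕ => x.2 / b x.1) hj hf
    (PT.snd.div (hb.comp PT.fst)) B (fun a t _ => by
      have := hB a
      simp only [e, size_nat] at *
      exact (Nat.div_le_self _ _).trans this)
  simp only [e] at h
  exact h.mod hb

/-- The truth values of `R` at `t - 1, …, 0`. -/
noncomputable def prevBits (R : ℕ → Prop) (t : ℕ) : List Γ' :=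
  open Classical in ((List.range t).map fun i => Γ'.bit (decide (R i))).reverse

theorem length_prevBits (R : ℕ → Prop) (t : ℕ) : (prevBits R t).length = t := by
  simp [prevBits]

/-- The table grows at its head, so the entry for `i` stands `t - 1 - i` places behind the most
recent one. -/
theorem getElem_prevBits {R : ℕ → Prop} {i t : ℕ} (h : i < t) :
    (prevBits R t)[t - 1 - i]? = some (.bit true) ↔ R i := by
  unfold prevBits
  rw [List.getElem?_reverse (by simp; omega)]
  simp only [List.length_map, List.length_range, show t - 1 - (t - 1 - i) = i by omega]
  simp [h]

/-- Course-of-values recursion. -/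
theorem PD.strongRec {R : α → ℕ → Prop} {G : (α × ℕ) × List Γ' → Prop} (hG : PD M G)
    (hR : ∀ a j, R a j ↔ G ((a, j), prevBits (R a) j)) : PD M fun x : α × ℕ => R x.1 x.2 := by
  classical
  -- The table of earlier truth values is the whole loop state: its length is the index to be
  -- decided next.
  let arg (x : (α × ℕ) × List Γ') : (α × ℕ) × List Γ' := ((x.1.1, x.2.length), x.2)
  have harg : PT M arg := ((PT.fst.comp PT.fst).pair (PT.length.comp PT.snd)).pair PT.snd
  let step (x : (α × ℕ) × List Γ') : List Γ' :=
    if G (arg x) then .bit true :: x.2 else .bit false :: x.2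
  have hstep : PT M step := PT.ite (hG.comp harg) ((PT.cons_const _).comp PT.snd)
    ((PT.cons_const _).comp PT.snd)
  have e (x : α × ℕ) (t : ℕ) : (fun b => step (x, b))^[t] [] = prevBits (R x.1) t := by
    induction t with
    | zero => simp [prevBits]
    | succ t ih =>
      rw [Function.iterate_succ_apply', ih]
      have : prevBits (R x.1) (t + 1) = .bit (decide (R x.1 t)) :: prevBits (R x.1) t := by
        simp [prevBits, List.range_succ]
      rw [this]
      have := hR x.1 t
      simp only [step, arg, length_prevBits]
      by_cases h : R x.1 t
      · simp [h, this.1 h]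
      · simp [h, mt this.2 h]
  have h := PT.iterate (N := fun x : α × ℕ => x.2) PT.snd (PT.const []) hstep .X (fun a t ht => by
    rw [e, size_list, length_prevBits, Polynomial.eval_X, size_pair, size_nat]
    omega)
  simp only [e] at h
  exact (hG.comp (PT.id.pair h)).congr fun x => hR x.1 x.2

end StackProgram

namespace StackProgram

open Enc

variable {α β : Type} [Enc α] [Enc β] {M : FinTM2}

/-! ### The decision machine of a program -/

/-- The output stack must have an alphabet equivalent to `Bool`, which `Γ'` is not, so the answer is
delivered on the output stack of `M`. Afterwards the answer register and the input are erased, since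
all other stacks have to be empty at the end. -/
theorem PT.solvable {f : α → Bool} (hf : PT M f) (hw : width α = 1) (e : M.Γ M.k₁ ≃ Bool) :
    Nonempty (TM2ComputableInPolyTime (fun a : α => enc a 0) encodeBool f) := by
  obtain ⟨⟨P, T, hP⟩, -⟩ := hf
  let Q : Cmd M := .seq (P 0 1 2) (.seq (.rite 1 (· == some (.bit true))
    (.push (.inr M.k₁) (e.symm true)) (.push (.inr M.k₁) (e.symm false)))
    (.seq (.pop (.inl 1)) (.loop (.inl 0) Option.isSome (.pop (.inl 0)))))
  have := M.kFin
  let F : Finset (ℕ ⊕ M.K) := Q.keys ∪ ({.inl 0} ∪ Finset.univ.image .inr)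
  have hF (k : M.K) : Sum.inr k ∈ F := by simp [F]
  have h0 : Sum.inl 0 ∈ F := by simp [F]
  have hQ : Q.keys ⊆ F := Finset.subset_union_left
  let m : Option Q.Lab → TM2.Stmt (TAlph F) (Option Q.Lab) (Bool × M.σ)
    | some l => compile hF Q some none l
    -- One extra step resets the test flag, because `haltList` demands the initial state.
    | none => .load (fun _ => (false, M.initialState)) .halt
  let tm : FinTM2 :=
    { K := F
      k₀ := ⟨.inl 0, h0⟩
      k₁ := ⟨.inr M.k₁, hF _⟩
      Γ := TAlph F
      Λ := Option Q.Lab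
      main := some Q.entry
      σ := Bool × M.σ
      initialState := (false, M.initialState)
      σFin := have := M.σFin; inferInstance
      Γk₀Fin := inferInstanceAs (Fintype Γ')
      m := m }
  let single (l : List Γ') (r : ℕ) : List Γ' := if r = 0 then l else []
  let result (b : Bool) : Store M :=
    Function.update (regs M fun _ => []) (.inr M.k₁) [e.symm b]
  have hrun (a : α) : ∃ t ≤ (T + 2 * .X + 5).eval (enc a 0).length,
      Runs Q (regs M (single (enc a 0))) t (result (f a)) := by
    have hsize : size a = (enc a 0).length := by simp [size, hw]
    obtain ⟨t, ht, h1⟩ := hP 0 1 2 (by omega) le_rfl (by omega) a (single (enc a 0))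
      (fun j hj => by
        obtain rfl : j = 0 := by omega
        rfl)
      (fun j hj => by simp [single]) (fun r hr => by simp [single, show r ≠ 0 by omega])
    let s1 : ℕ → List Γ' := put (single (enc a 0)) 1 1 fun _ => [.bit (f a)]
    change Runs (P 0 1 2) (regs M (single (enc a 0))) t (regs M s1) at h1
    have hs1 : s1 1 = [.bit (f a)] := put_add _ 1 1 0 _ Nat.one_pos
    have h2 : Runs (.rite 1 (· == some (.bit true)) (.push (.inr M.k₁) (e.symm true))
        (.push (.inr M.k₁) (e.symm false))) (regs M s1) 2
        (Function.update (regs M s1) (.inr M.k₁) [e.symm (f a)]) := by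
      cases hfa : f a
      · refine .iteFalse ?_ (.push _ _ _)
        change ((s1 1).head? == some (.bit true)) = false
        rw [hs1, hfa]
        rfl
      · refine .iteTrue ?_ (.push _ _ _)
        change ((s1 1).head? == some (.bit true)) = true
        rw [hs1, hfa]
        rfl
    have hne (r : ℕ) : (Sum.inl r : ℕ ⊕ M.K) ≠ .inr M.k₁ := Sum.inl_ne_inr
    have h3 : Runs (.pop (.inl 1)) (Function.update (regs M s1) (.inr M.k₁) [e.symm (f a)]) 1
        (Function.update (regs M (single (enc a 0))) (.inr M.k₁) [e.symm (f a)]) := by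
      convert Runs.pop (M := M) (.inl 1) _ using 1
      rw [Function.update_of_ne (hne 1), Function.update_comm (hne 1).symm]
      congr 1
      refine Eq.trans ?_ (regs_update s1 1 _).symm
      congr 1
      funext r
      change _ = Function.update s1 1 (s1 1).tail r
      rw [hs1]
      simp only [s1, single]
      grind [put, Function.update_apply]
    have h4 (l : List Γ') : Runs (.loop (.inl 0) Option.isSome (.pop (.inl 0)))
        (Function.update (regs M (single l)) (.inr M.k₁) [e.symm (f a)]) (2 * l.length + 1)
        (result (f a)) := by
      have htop (l : List Γ') : Function.update (regs M (single l)) (.inr M.k₁) [e.symm (f a)]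
          (.inl 0) = l := by
        rw [Function.update_of_ne (hne 0)]
        rfl
      induction l with
      | nil =>
        have : single [] = fun _ => [] := by
          funext r
          simp [single]
        refine Eq.subst (motive := fun s => Runs _ _ _ s) ?_ (Runs.loopFalse ?_)
        · simp only [result, this]
        · rw [htop]
          rfl
      | cons c l ih =>
        have h := Runs.pop (M := M) (.inl 0)
          (Function.update (regs M (single (c :: l))) (.inr M.k₁) [e.symm (f a)])
        rw [htop, Function.update_comm (hne 0).symm] at h
        have hu : Function.update (regs M (single (c :: l))) (.inl 0) l = regs M (single l) := by
          refine (regs_update _ _ _).trans ?_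
          congr 1
          funext r
          simp only [single]
          grind [Function.update_apply]
        have h' := Runs.loopTrue (P := Option.isSome) (by rw [htop]; rfl)
          (Eq.subst (motive := fun s => Runs _ _ _ (Function.update s _ _)) hu h) ih
        convert h' using 1
        rw [List.length_cons]
        ring
    refine ⟨_, ?_, h1.seq (h2.seq (h3.seq (h4 _)))⟩
    rw [← hsize]
    simp only [Polynomial.eval_add, Polynomial.eval_mul, Polynomial.eval_X, Polynomial.eval_ofNat]
    omega
  choose t ht hrun using hrun
  have hsteps (a : α) := (hrun a).steps hF hQ m some none (fun _ => rfl) false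
  choose b hb using hsteps
  refine ⟨⟨⟨tm, Equiv.refl _, e⟩, T + 2 * .X + 6, fun a => ⟨⟨t a + 1, ?_⟩, ?_⟩⟩⟩
  · have hinit : initList tm ((enc a 0).map (Equiv.refl Γ').invFun) =
        ⟨some (some Q.entry), (false, M.initialState), restrict F (regs M (single (enc a 0)))⟩ := by
      unfold initList
      congr 1
      funext ⟨k, hk⟩
      rcases k with r | k
      · by_cases hr : r = 0
        · subst hr
          exact (dif_pos rfl).trans (List.map_id _)
        · refine (dif_neg fun h => hr ?_).trans (if_neg hr).symm
          exact Sum.inl.inj (Subtype.ext_iff.1 h)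
      · exact dif_neg fun h => Sum.inr_ne_inl (Subtype.ext_iff.1 h)
    have hhalt : haltList tm ((encodeBool (f a)).map e.invFun) =
        ⟨none, (false, M.initialState), restrict F (result (f a))⟩ := by
      unfold haltList
      congr 1
      funext ⟨k, hk⟩
      by_cases hk' : k = .inr M.k₁
      · subst hk'
        have : result (f a) (.inr M.k₁) = [e.symm (f a)] := Function.update_self _ _ _
        exact (dif_pos rfl).trans this.symm
      · have : result (f a) k = [] := by
          refine (Function.update_of_ne hk' _ _).trans ?_
          rcases k with r | k <;> rfl
        exact (dif_neg fun h => hk' (Subtype.ext_iff.1 h)).trans this.symm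
    change (flip bind (TM2.step m))^[t a + 1] (some (initList tm ((enc a 0).map
      (Equiv.refl Γ').invFun))) = some (haltList tm ((encodeBool (f a)).map e.invFun))
    rw [hinit, hhalt]
    exact (hb a).trans (Steps.of_step rfl)
  · have := ht a
    simp only [Polynomial.eval_add, Polynomial.eval_mul, Polynomial.eval_X,
      Polynomial.eval_ofNat] at *
    omega

/-! ### Calls of the machine -/

theorem regs_eq_combine (s : ℕ → List Γ') : regs M s = combine (regs M s) fun _ => [] := by
  funext k
  rcases k with r | k <;> rfl

theorem combine_regs_update (s : ℕ → List Γ') (O : ∀ k, List (M.Γ k)) (r : ℕ) (v : List Γ') :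
    Function.update (combine (regs M s) O) (.inl r) v =
      combine (regs M (Function.update s r v)) O := by
  funext j
  rcases j with j | j
  · by_cases hj : j = r
    · subst hj
      exact (Function.update_self (β := fun k => List (Alph M k)) _ _ _).trans
        (Function.update_self (β := fun _ => List Γ') _ _ _).symm
    · exact (Function.update_of_ne (β := fun k => List (Alph M k))
          (fun e => hj (Sum.inl.inj e)) _ _).trans
        (Function.update_of_ne (β := fun _ => List Γ') hj _ _).symm
  · exact Function.update_of_ne Sum.inr_ne_inl _ _

theorem Runs.congr {p : Cmd M} {s s' s'' : Store M} {t : ℕ} (h : Runs p s t s') (e : s' = s'') :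
    Runs p s t s'' := e ▸ h

theorem Runs.congr_time {p : Cmd M} {s s' : Store M} {t t' : ℕ} (h : Runs p s t s')
    (e : t = t') : Runs p s t' s' := e ▸ h

/-- Move a register to a stack of the machine, replacing each symbol by `c`. -/
def feed (x : ℕ) (k : M.K) (c : M.Γ k) : Cmd M :=
  .loop (.inl x) Option.isSome (.seq (.pop (.inl x)) (.push (.inr k) c))

theorem runs_feed (x : ℕ) (k : M.K) (c : M.Γ k) (s : ℕ → List Γ') (O : ∀ k, List (M.Γ k)) :
    Runs (feed x k c) (combine (regs M s) O) (3 * (s x).length + 1)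
      (combine (regs M (Function.update s x []))
        (Function.update O k (List.replicate (s x).length c ++ O k))) := by
  generalize hl : s x = l
  induction l generalizing s O with
  | nil =>
    refine (Runs.loopFalse ?_).congr ?_
    · change (s x).head?.isSome = false
      rw [hl]
      rfl
    · rw [← hl, Function.update_eq_self, hl, List.length_nil, List.replicate_zero, List.nil_append,
        Function.update_eq_self]
  | cons a l ih =>
    have ih' := ih (Function.update s x l) (Function.update O k (c :: O k)) (by simp)
    rw [Function.update_idem, Function.update_idem, Function.update_self] at ih'
    have h1 : Runs (.pop (.inl x)) (combine (regs M s) O) 1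
        (combine (regs M (Function.update s x l)) O) := by
      refine (Runs.pop _ _).congr ((combine_regs_update s O x (s x).tail).trans ?_)
      rw [hl, List.tail_cons]
    have h2 : Runs (.push (.inr k) c) (combine (regs M (Function.update s x l)) O) 1
        (combine (regs M (Function.update s x l)) (Function.update O k (c :: O k))) :=
      (Runs.push _ _ _).congr (combine_update _ O k (c :: O k))
    have h := Runs.loopTrue (P := Option.isSome) (k := .inl x)
      (by change (s x).head?.isSome = true; rw [hl]; rfl) (h1.seq h2) ih'
    have e : List.replicate (a :: l).length c ++ O k = List.replicate l.length c ++ c :: O k := by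
      rw [List.length_cons, List.replicate_succ', List.append_assoc]
      rfl
    rw [e]
    exact h.congr_time (by rw [List.length_cons]; ring)

/-- Move a stack of the machine to a register as a sequence of bits. -/
def drain (k : M.K) (P : M.Γ k → Bool) (o : ℕ) : Cmd M :=
  .loop (.inr k) Option.isSome (.seq (.ite (.inr k) (fun c => c.elim false P)
    (.push (.inl o) (Γ'.bit true)) (.push (.inl o) (Γ'.bit false))) (.pop (.inr k)))

theorem runs_drain (k : M.K) (P : M.Γ k → Bool) (o : ℕ) (s : ℕ → List Γ')
    (O : ∀ k, List (M.Γ k)) :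
    Runs (drain k P o) (combine (regs M s) O) (4 * (O k).length + 1)
      (combine (regs M (Function.update s o
        (((O k).map fun c => Γ'.bit (P c)).reverse ++ s o))) (Function.update O k [])) := by
  generalize hl : O k = l
  induction l generalizing s O with
  | nil =>
    refine (Runs.loopFalse ?_).congr ?_
    · change (O k).head?.isSome = false
      rw [hl]
      rfl
    · rw [← hl, Function.update_eq_self]
      simp [hl]
  | cons a l ih =>
    have ih' := ih (Function.update s o (.bit (P a) :: s o)) (Function.update O k l) (by simp)
    rw [Function.update_idem, Function.update_idem, Function.update_self] at ih'
    have h1 : Runs (.ite (.inr k) (fun c => c.elim false P) (.push (.inl o) (Γ'.bit true))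
        (.push (.inl o) (Γ'.bit false))) (combine (regs M s) O) 2
        (combine (regs M (Function.update s o (.bit (P a) :: s o))) O) := by
      have ht : ((combine (regs M s) O (.inr k)).head?.elim false P) = P a := by
        change (O k).head?.elim false P = _
        rw [hl]
        rfl
      cases hPa : P a
      · exact .iteFalse (ht.trans hPa)
          ((Runs.push _ _ _).congr (combine_regs_update s O o (.bit false :: s o)))
      · exact .iteTrue (ht.trans hPa)
          ((Runs.push _ _ _).congr (combine_regs_update s O o (.bit true :: s o)))
    have h2 (s : ℕ → List Γ') : Runs (.pop (.inr k)) (combine (regs M s) O) 1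
        (combine (regs M s) (Function.update O k l)) := by
      refine (Runs.pop _ _).congr ((combine_update _ O k (O k).tail).trans ?_)
      rw [hl, List.tail_cons]
    have h := Runs.loopTrue (P := Option.isSome) (k := .inr k)
      (by change (O k).head?.isSome = true; rw [hl]; rfl) (h1.seq (h2 _)) ih'
    have e : ((a :: l).map fun c => Γ'.bit (P c)).reverse ++ s o =
        (l.map fun c => Γ'.bit (P c)).reverse ++ .bit (P a) :: s o := by simp
    rw [e]
    exact h.congr_time (by rw [List.length_cons]; ring)

theorem unaryEncodeNat_eq (n : ℕ) : unaryEncodeNat n = List.replicate n true := by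
  induction n with
  | zero => rfl
  | succ n ih => rw [unaryEncodeNat, ih, List.replicate_succ]

/-- The value of a binary word, its most significant bit first. -/
def binaryValue (l : List Γ') : ℕ := l.foldl (fun v c => 2 * v + if c = .bit true then 1 else 0) 0

theorem binaryValue_append (l : List Γ') (c : Γ') :
    binaryValue (l ++ [c]) = 2 * binaryValue l + if c = .bit true then 1 else 0 := by
  simp [binaryValue]

/-- The binary representation of a number, its most significant bit first. -/
def binaryWord (n : ℕ) : List Γ' := ((encodeNat n).map Γ'.bit).reverse

theorem binaryValue_binaryWord (n : ℕ) : binaryValue (binaryWord n) = n := by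
  have hpos (p : PosNum) : binaryValue ((encodePosNum p).map Γ'.bit).reverse = (p : ℕ) := by
    induction p with
    | one => rfl
    | bit1 p ih =>
      rw [encodePosNum, List.map_cons, List.reverse_cons, binaryValue_append, ih,
        PosNum.cast_bit1]
      simp
      omega
    | bit0 p ih =>
      rw [encodePosNum, List.map_cons, List.reverse_cons, binaryValue_append, ih,
        PosNum.cast_bit0]
      simp
      omega
  conv_rhs => rw [← Num.to_of_nat n]
  unfold binaryWord encodeNat
  rcases (n : Num) with _ | p
  · rfl
  · exact hpos p

/-- This crude bound suffices, since it is applied to values that are themselves polynomially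
bounded. -/
theorem length_binaryWord_le (n : ℕ) : (binaryWord n).length ≤ n := by
  have hpos (p : PosNum) : (encodePosNum p).length ≤ (p : ℕ) := by
    induction p with
    | one => exact le_rfl
    | bit1 p ih =>
      rw [encodePosNum, List.length_cons, PosNum.cast_bit1]
      omega
    | bit0 p ih =>
      have := PosNum.cast_pos (α := ℕ) p
      rw [encodePosNum, List.length_cons, PosNum.cast_bit0]
      omega
  conv_rhs => rw [← Num.to_of_nat n]
  unfold binaryWord encodeNat
  rw [List.length_reverse, List.length_map]
  rcases (n : Num) with _ | p
  · exact le_rfl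
  · exact hpos p

variable {p : ℕ × ℕ → Prop} {f : {q : ℕ × ℕ // p q} → ℕ}

/-- The arguments are loaded on the input stack of the machine, and after the call the output is
unloaded. Unloading reverses the word: `encodeNat` starts with the least significant bit, the
register with the most significant one. -/
theorem PT.binaryWord_call (h : TM2ComputableInPolyTime (fun q : {q : ℕ × ℕ // p q} =>
      (encodingProd unaryEncodingNat unaryEncodingNat).encode q.1) encodeNat f)
    (B : Polynomial ℕ) (hB : ∀ q, f q ≤ B.eval (size q)) :
    PT h.tm fun q => binaryWord (f q) := by
  let k₀ := h.tm.k₀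
  let k₁ := h.tm.k₁
  let c : h.tm.Γ k₀ := h.inputAlphabet.symm (.inl true)
  let d : h.tm.Γ k₀ := h.inputAlphabet.symm (.inr true)
  refine ⟨⟨fun i o n => .seq (.copy (i + 1) n (n + 2) 1) <| .seq (.copy i (n + 1) (n + 2) 1) <|
    -- The second argument is pushed first, so that the first one ends up on top.
    .seq (feed n k₀ d) <| .seq (feed (n + 1) k₀ c) <|
    .seq .call (drain k₁ h.outputAlphabet o), 20 * .X + h.time + 4 * B + 9, ?_⟩, B, fun q => ?_⟩
  · rintro i o n hi ho hio ⟨⟨m, j⟩, hq⟩ s hs hs' hn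
    change i + 2 ≤ n at hi
    change o + 1 ≤ n at ho
    change i + 2 ≤ o ∨ o + 1 ≤ i at hio
    have hsi : s i = List.replicate m (.bit true) := hs 0 Nat.two_pos
    have hsj : s (i + 1) = List.replicate j (.bit true) := hs 1 Nat.one_lt_two
    have hso : s o = [] := hs' 0 Nat.one_pos
    let s1 : ℕ → List Γ' := Function.update s n (List.replicate j (.bit true))
    let s2 : ℕ → List Γ' := Function.update s1 (n + 1) (List.replicate m (.bit true))
    let s3 : ℕ → List Γ' := Function.update s (n + 1) (List.replicate m (.bit true))
    have hcopy (x y v : ℕ) (s : ℕ → List Γ') (hx : x < n) (hy : n ≤ y) (hy' : y < n + 2)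
        (hv : s x = List.replicate v (.bit true)) (hsy : s y = []) (hsn : s (n + 2) = []) :
        RunsIn (M := h.tm) (.copy x y (n + 2) 1) s (17 * v + 2 * 1 + 1)
          (Function.update s y (List.replicate v (.bit true))) := by
      refine ((RunsIn.copy_enc (a := v) (i := x) (o := y) (n := n + 2)
        (by change x + 1 ≤ _; omega) hy' (by change x + 1 ≤ _ ∨ _; omega) (fun z hz => ?_)
        (fun z hz => ?_) hsn).mono (by rw [size_nat]; rfl)).congr ?_
      · obtain rfl : z = 0 := Nat.lt_one_iff.1 hz
        exact hv
      · obtain rfl : z = 0 := Nat.lt_one_iff.1 hz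
        exact hsy
      · funext r
        change put s y 1 (fun _ => List.replicate v (.bit true)) r = _
        grind [put, Function.update_apply]
    obtain ⟨t1, ht1, h1⟩ := hcopy (i + 1) n j s (by omega) le_rfl (by omega) hsj (hn _ le_rfl)
      (hn _ (by omega))
    obtain ⟨t2, ht2, h2⟩ := hcopy i (n + 1) m s1 (by omega) (by omega) (by omega)
      (by rw [← hsi]; exact Function.update_of_ne (by omega) _ _)
      ((Function.update_of_ne (by omega) _ _).trans (hn _ (by omega)))
      ((Function.update_of_ne (by omega) _ _).trans (hn _ (by omega)))
    rw [regs_eq_combine (Function.update s1 (n + 1) _)] at h2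
    have e2 : s2 n = List.replicate j (.bit true) := by
      refine (Function.update_of_ne (by omega) _ _).trans ?_
      exact Function.update_self (β := fun _ => List Γ') _ _ _
    have e3 : Function.update s2 n [] = s3 := by
      have := hn n le_rfl
      funext r
      simp only [s2, s1, s3]
      grind [Function.update_apply]
    have e4 : s3 (n + 1) = List.replicate m (.bit true) :=
      Function.update_self (β := fun _ => List Γ') _ _ _
    have e5 : Function.update s3 (n + 1) [] = s := by
      have := hn (n + 1) (by omega)
      funext r
      simp only [s3]
      grind [Function.update_apply]
    have h3 := runs_feed (M := h.tm) n k₀ d s2 fun _ => []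
    rw [e2, e3, List.length_replicate, List.append_nil] at h3
    have h4 := runs_feed (M := h.tm) (n + 1) k₀ c s3
      (Function.update (fun _ => []) k₀ (List.replicate j d))
    rw [e4, e5, List.length_replicate, Function.update_self, Function.update_idem] at h4
    obtain ⟨⟨t5, h5⟩, ht5⟩ := h.outputsFun ⟨(m, j), hq⟩
    have hlen : ((encodingProd unaryEncodingNat unaryEncodingNat).encode (m, j)).length =
        m + j := by
      simp [encodingProd, unaryEncodingNat, unaryEncodeNat_eq]
    rw [hlen] at ht5
    let out : List (h.tm.Γ k₁) := (encodeNat (f ⟨(m, j), hq⟩)).map h.outputAlphabet.symm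
    have h5' : Runs (M := h.tm) .call (combine (regs h.tm s) (Function.update (fun _ => []) k₀
        (List.replicate m c ++ List.replicate j d))) t5
        (combine (regs h.tm s) (Function.update (fun _ => []) k₁ out)) := by
      refine .call (fun r => rfl) ?_
      have hin : initList h.tm (((encodingProd unaryEncodingNat unaryEncodingNat).encode
          (m, j)).map h.inputAlphabet.invFun) = ⟨some h.tm.main, h.tm.initialState,
            Function.update (fun _ => []) k₀ (List.replicate m c ++ List.replicate j d)⟩ := by
        unfold initList
        congr 1
        funext k
        by_cases hk : k = h.tm.k₀
        · subst hk
          refine (dif_pos rfl).trans (Eq.trans ?_ (Function.update_self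
            (β := fun k => List (h.tm.Γ k)) _ _ _).symm)
          simp only [encodingProd, unaryEncodingNat, unaryEncodeNat_eq, List.map_replicate,
            List.map_append]
          rfl
        · refine (dif_neg hk).trans (Eq.symm ?_)
          exact Function.update_of_ne hk _ _
      have hout : haltList h.tm ((encodeNat (f ⟨(m, j), hq⟩)).map h.outputAlphabet.invFun) =
          ⟨none, h.tm.initialState, Function.update (fun _ => []) k₁ out⟩ := by
        unfold haltList
        congr 1
        funext k
        by_cases hk : k = h.tm.k₁
        · subst hk
          exact (dif_pos rfl).trans (Function.update_self
            (β := fun k => List (h.tm.Γ k)) _ _ _).symm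
        · refine (dif_neg hk).trans (Eq.symm ?_)
          exact Function.update_of_ne hk _ _
      have h5 : (flip bind (TM2.step h.tm.m))^[t5] (some (initList h.tm _)) =
        some (haltList h.tm _) := h5
      rw [hin, hout] at h5
      exact h5
    have h6 := runs_drain (M := h.tm) k₁ h.outputAlphabet o s (Function.update (fun _ => []) k₁ out)
    have e6 : (out.map fun c => Γ'.bit (h.outputAlphabet c)).reverse =
        binaryWord (f ⟨(m, j), hq⟩) := by
      simp [out, binaryWord, Function.comp_def]
    rw [Function.update_self, e6, hso, List.append_nil, Function.update_idem,
      Function.update_eq_self k₁ (fun _ : h.tm.K => ([] : List (h.tm.Γ _))), ← regs_eq_combine]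
      at h6
    refine ⟨_, ?_, (h1.seq (h2.seq (h3.seq (h4.seq (h5'.seq h6))))).congr ?_⟩
    · have hl : out.length ≤ f ⟨(m, j), hq⟩ := by
        refine le_of_eq_of_le ?_ (length_binaryWord_le _)
        simp [out, binaryWord]
      have hb := hB ⟨(m, j), hq⟩
      have hsize : size (⟨(m, j), hq⟩ : {q : ℕ × ℕ // p q}) = m + j := by
        change size (m, j) = _
        simp
      rw [hsize] at hb ⊢
      simp only [Polynomial.eval_add, Polynomial.eval_mul, Polynomial.eval_X,
        Polynomial.eval_ofNat]
      change t5 ≤ _ at ht5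
      omega
    · congr 1
      funext r
      change _ = put s o 1 (fun _ => binaryWord (f ⟨(m, j), hq⟩)) r
      grind [put, Function.update_apply]
  · rw [size_list]
    exact (length_binaryWord_le _).trans (hB q)

/-- A function with numbers as arguments that a Turing machine computes in polynomial time, with
the result in binary, is computed in unary by a program if its values are bounded by a
polynomial. -/
theorem PT.call (h : TM2ComputableInPolyTime (fun q : {q : ℕ × ℕ // p q} =>
      (encodingProd unaryEncodingNat unaryEncodingNat).encode q.1) encodeNat f)
    (B : Polynomial ℕ) (hB : ∀ q, f q ≤ B.eval (size q)) : PT h.tm f := by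
  have hw := PT.binaryWord_call h B hB
  let step (x : {q : ℕ × ℕ // p q} × ℕ × List Γ') : ℕ × List Γ' :=
    (2 * x.2.1 + if x.2.2.head? = some (.bit true) then 1 else 0, x.2.2.tail)
  have hstep : PT h.tm step := by
    refine PT.pair (PT.add ((PT.const 2).mul (PT.fst.comp PT.snd)) ?_)
      (PT.tail.comp (PT.snd.comp PT.snd))
    refine (PT.cond ((PT.testHead (· == some (.bit true))).comp (PT.snd.comp PT.snd))
      (PT.const 1) (PT.const 0)).recode rfl fun x _ _ => ?_
    by_cases hx : x.2.2.head? = some (.bit true)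
    · simp [hx]
    · simp only [hx, if_false, beq_false_of_ne hx, cond_false]
  have e (q : {q : ℕ × ℕ // p q}) (l : List Γ') (t : ℕ) (ht : t ≤ l.length) :
      (fun b => step (q, b))^[t] (0, l) = (binaryValue (l.take t), l.drop t) := by
    induction t with
    | zero => simp [binaryValue]
    | succ t ih =>
      rw [Function.iterate_succ_apply', ih (by omega), List.take_add_one,
        List.getElem?_eq_getElem ht, Option.toList_some, binaryValue_append]
      simp only [step, List.head?_drop, List.tail_drop, List.getElem?_eq_getElem ht,
        Option.some.injEq]
  -- Horner's scheme passes through the values of the prefixes. They do not exceed the final value,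
  -- so the conversion to unary keeps polynomial size.
  have hmono (l : List Γ') (t : ℕ) : binaryValue (l.take t) ≤ binaryValue l := by
    have key (l' : List Γ') : binaryValue (l.take t) ≤ binaryValue (l.take t ++ l') := by
      induction l' using List.reverseRecOn with
      | nil => simp
      | append_singleton l' c ih =>
        rw [← List.append_assoc, binaryValue_append]
        omega
    simpa using key (l.drop t)
  have hi := PT.iterate (PT.length.comp hw) ((PT.const 0).pair hw) hstep (2 * B) (fun q t ht => by
    have h1 := hmono (binaryWord (f q)) t
    have h2 := length_binaryWord_le (f q)
    have h3 := hB q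
    rw [binaryValue_binaryWord] at h1
    rw [e q _ t ht]
    simp only [size_pair, size_nat, size_list, List.length_drop, Polynomial.eval_mul,
      Polynomial.eval_ofNat]
    omega)
  refine (PT.fst.comp hi).recode rfl fun q _ _ => ?_
  rw [e q _ _ le_rfl, List.take_length, binaryValue_binaryWord]

end StackProgram

/-! ### Positions in linear extensions -/

/-! ### Unit jobs with release times, deadlines and precedence -/

section Schedule

variable {ι : Type*}

open Classical in
/-- Unit jobs with release times `r` and deadlines `d` that are compatible with a partial order
can be scheduled compatibly with the order if no time interval has too many jobs. -/
theorem exists_schedule (P : ι → ι → Prop) (hP : IsPartialOrder ι P) (d : ι → ℕ)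
    (hd : ∀ x y, P x y → d x ≤ d y) (X : Finset ι) (r : ι → ℕ) (hr : ∀ x y, P x y → r x ≤ r y)
    (H : ∀ a b, (X.filter fun x => a ≤ r x ∧ d x ≤ b).card ≤ b + 1 - a) :
    ∃ pos : ι → ℕ, (∀ x ∈ X, r x ≤ pos x ∧ pos x ≤ d x) ∧
      (∀ x ∈ X, ∀ y ∈ X, pos x = pos y → x = y) ∧
      ∀ x ∈ X, ∀ y ∈ X, P x y → pos x ≤ pos y := by
  induction hn : X.card generalizing X r with
  | zero =>
    rw [Finset.card_eq_zero] at hn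
    subst hn
    exact ⟨fun _ => 0, by simp, by simp, by simp⟩
  | succ n ih =>
    -- Greedy choice of the first job `x`: earliest release time, among those earliest deadline,
    -- among those fewest predecessors in `X`.
    obtain ⟨x₀, hx₀, hmin₀⟩ := X.exists_min_image r (Finset.card_pos.1 (by omega))
    obtain ⟨x₁, hx₁, hmin₁⟩ := (X.filter fun x => r x = r x₀).exists_min_image d
      ⟨x₀, by simp [hx₀]⟩
    obtain ⟨x, hx, hmin⟩ := (X.filter fun x => r x = r x₀ ∧ d x = d x₁).exists_min_image
      (fun y => (X.filter fun z => P z y).card) ⟨x₁, by simpa using hx₁⟩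
    simp only [Finset.mem_filter] at hx hx₁ hmin₁ hmin
    obtain ⟨hxX, hrx, hdx⟩ := hx
    rw [← hrx] at hmin₀ hmin₁ hmin
    rw [← hdx] at hmin₁ hmin
    -- A predecessor of `x` has no later release time and deadline, hence ties with `x` in both. If
    -- it differed from `x`, it would have strictly fewer predecessors.
    have hbefore (y : ι) (hy : y ∈ X) (hyx : P y x) : y = x := by
      by_contra hne
      have h1 : r y = r x := le_antisymm (hr _ _ hyx) (hmin₀ y hy)
      have h2 : d y = d x := le_antisymm (hd _ _ hyx) (hmin₁ y ⟨hy, h1⟩)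
      refine absurd (hmin y ⟨hy, h1, h2⟩) (not_le.2 (Finset.card_lt_card ?_))
      refine Finset.ssubset_iff_subset_ne.2 ⟨fun z hz => ?_, fun h => ?_⟩
      · rw [Finset.mem_filter] at hz ⊢
        exact ⟨hz.1, hP.trans _ _ _ hz.2 hyx⟩
      · have : x ∈ X.filter fun z => P z y := by
          rw [h, Finset.mem_filter]
          exact ⟨hxX, hP.refl x⟩
        exact hne (hP.antisymm _ _ hyx (Finset.mem_filter.1 this).2)
    have hrd : r x ≤ d x := by
      have h1 : 0 < (X.filter fun y => r x ≤ r y ∧ d y ≤ d x).card :=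
        Finset.card_pos.2 ⟨x, by simp [hxX]⟩
      have := H (r x) (d x)
      omega
    -- The job `x` occupies slot `r x` and all others are released later. Intervals that start after
    -- `r x + 1` are not affected by the change.
    obtain ⟨pos, hpos, hinj, hmono⟩ := ih (X.erase x) (fun y => max (r y) (r x + 1))
      (fun y z hyz => max_le_max (hr y z hyz) le_rfl)
      (fun a b => by
        rcases Nat.lt_or_ge (r x + 1) a with ha | ha
        · refine (Finset.card_le_card fun y hy => ?_).trans (H a b)
          simp only [Finset.mem_filter, Finset.mem_erase] at hy ⊢
          refine ⟨hy.1.2, ?_, hy.2.2⟩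
          rcases le_max_iff.1 hy.2.1 with h | h <;> omega
        -- Now every remaining job is released at `a` or later, so it is enough that at most `b - r
        -- x` of them are due by `b`.
        · refine le_trans ?_ (show b - r x ≤ b + 1 - a by omega)
          rcases Nat.lt_or_ge b (d x) with hb | hb
          -- If `b < d x`, the choice of the earliest deadline implies that jobs due by `b` were
          -- already released after `r x`.
          · refine le_trans (Finset.card_le_card fun y hy => ?_)
              ((H (r x + 1) b).trans (by omega))
            simp only [Finset.mem_filter, Finset.mem_erase] at hy ⊢
            refine ⟨hy.1.2, ?_, hy.2.2⟩
            have h1 := hmin₀ y hy.1.2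
            by_contra h2
            have := hmin₁ y ⟨hy.1.2, by omega⟩
            omega
          -- If `d x ≤ b`, the job `x` itself was counted in the interval from `r x` to `b`, and its
          -- removal frees the slot that it takes.
          · have h1 := H (r x) b
            have h2 : ((X.erase x).filter fun y => a ≤ max (r y) (r x + 1) ∧ d y ≤ b).card <
                (X.filter fun y => r x ≤ r y ∧ d y ≤ b).card := by
              refine Finset.card_lt_card ((Finset.ssubset_iff_of_subset fun y hy => ?_).2 ?_)
              · simp only [Finset.mem_filter, Finset.mem_erase] at hy ⊢
                exact ⟨hy.1.2, hmin₀ y hy.1.2, hy.2.2⟩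
              · exact ⟨x, by simp [hxX, hb], by simp⟩
            omega)
      (by rw [Finset.card_erase_of_mem hxX, hn]; rfl)
    have hlate (y : ι) (hy : y ∈ X) (hne : y ≠ x) : r y ≤ pos y ∧ r x < pos y ∧ pos y ≤ d y := by
      have := hpos y (Finset.mem_erase.2 ⟨hne, hy⟩)
      have h1 := le_max_left (r y) (r x + 1)
      have h2 := le_max_right (r y) (r x + 1)
      omega
    refine ⟨fun y => if y = x then r x else pos y, fun y hy => ?_, fun y hy z hz h => ?_,
      fun y hy z hz h => ?_⟩
    · by_cases hyx : y = x
      · simp [hyx, hrd]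
      · simp only [hyx, if_false]
        have := hlate y hy hyx
        omega
    · by_cases hyx : y = x <;> by_cases hzx : z = x <;> simp only [hyx, hzx, if_true, if_false] at h ⊢
      · have := hlate z hz hzx
        omega
      · have := hlate y hy hyx
        omega
      · exact hinj y (Finset.mem_erase.2 ⟨hyx, hy⟩) z (Finset.mem_erase.2 ⟨hzx, hz⟩) h
    · by_cases hyx : y = x
      · subst hyx
        by_cases hzx : z = y
        · simp [hzx]
        · have := hlate z hz hzx
          simp only [hzx, if_true, if_false]
          omega
      · by_cases hzx : z = x
        · subst hzx
          exact absurd (hbefore y hy h) hyx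
        · simp only [hyx, hzx, if_false]
          exact hmono y (Finset.mem_erase.2 ⟨hyx, hy⟩) z (Finset.mem_erase.2 ⟨hzx, hz⟩) h

end Schedule

/-! ### Linear extensions with prescribed positions -/

section Position

variable {m : ℕ} {T : Fin m → Fin m → Prop}

theorem position_mono (hT : IsLinearOrder (Fin m) T) {x y : Fin m} (h : T x y) :
    position T x ≤ position T y :=
  Set.ncard_le_ncard fun _ hz => hT.trans _ _ _ hz h

theorem position_injective (hT : IsLinearOrder (Fin m) T) : Function.Injective (position T) := by
  have key (x y : Fin m) (h : T x y) (hne : x ≠ y) : position T x < position T y := by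
    refine Set.ncard_lt_ncard ((Set.ssubset_iff_of_subset fun _ hz => hT.trans _ _ _ hz h).2
      ⟨y, hT.refl y, fun h' => hne (hT.antisymm _ _ h h')⟩)
  intro x y h
  by_contra hne
  rcases hT.total x y with h' | h'
  · exact (key x y h' hne).ne h
  · exact (key y x h' (Ne.symm hne)).ne h.symm

theorem position_pos (hT : IsLinearOrder (Fin m) T) (x : Fin m) : 0 < position T x :=
  (Set.ncard_pos).2 ⟨x, hT.refl x⟩

theorem position_le (x : Fin m) : position T x ≤ m := by
  simpa [position] using Set.ncard_le_card {z | T z x}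

/-- An injection of `m` elements into the numbers below `m` is a bijection, so no slot is left
empty. The shift by one is from slots counted from 0 to positions counted from 1. -/
theorem position_of_injective {f : Fin m → ℕ} (hf : Function.Injective f) (hm : ∀ x, f x < m)
    (c : Fin m) : position (fun x y => f x ≤ f y) c = f c + 1 := by
  let g (x : Fin m) : Fin m := ⟨f x, hm x⟩
  have hg : Function.Injective g := fun x y h => hf (Fin.mk.inj h)
  have hs : Function.Surjective g := Finite.injective_iff_surjective.1 hg
  have : {x | f x ≤ f c} = g ⁻¹' Set.Iic (g c) := rfl
  unfold position
  rw [this, Set.ncard_preimage_of_injective_subset_range hg (by simp [hs.range_eq]),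
    Set.ncard_eq_toFinset_card']
  simp [g]

open Classical in
/-- A partial order has a linear extension with given positions of some elements if and only if
no interval of positions has too many elements. -/
theorem exists_linearExtension_iff {P : Fin m → Fin m → Prop} (hP : IsPartialOrder (Fin m) P)
    (hm : 0 < m) {q : ℕ} (e p : Fin q → Fin m) :
    (∃ T, IsLinearOrder (Fin m) T ∧ (∀ x y, P x y → T x y) ∧
        ∀ j, position T (e j) = p j + 1) ↔
      ∀ a < m, ∀ b < m, (Finset.univ.filter fun x =>
        (a = 0 ∨ ∃ j, P (e j) x ∧ a ≤ p j) ∧ (b + 1 = m ∨ ∃ j, P x (e j) ∧ p j ≤ b)).card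
          ≤ b + 1 - a := by
  constructor
  · rintro ⟨T, hT, hPT, hpos⟩ a ha b hb
    -- Necessity: the counted elements have distinct positions between `a + 1` and `b + 1`.
    refine (Finset.card_le_card_of_injOn (t := Finset.Icc (a + 1) (b + 1)) (position T)
      (fun x hx => ?_) (position_injective hT).injOn).trans (by simp)
    simp only [Finset.coe_filter, Finset.mem_univ, true_and, Set.mem_ofPred_eq] at hx
    rw [Finset.coe_Icc, Set.mem_Icc]
    constructor
    · rcases hx.1 with h | ⟨j, hj, h⟩
      · have := position_pos hT x
        omega
      · have := position_mono hT (hPT _ _ hj)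
        rw [hpos] at this
        omega
    · rcases hx.2 with h | ⟨j, hj, h⟩
      · have := position_le (T := T) x
        omega
      · have := position_mono hT (hPT _ _ hj)
        rw [hpos] at this
        omega
  · intro H
    -- The release time is the latest slot prescribed to an element below `x`, and 0 if there is
    -- none.
    let r (x : Fin m) : ℕ := (Finset.univ.filter fun j => P (e j) x).sup fun j => (p j : ℕ)
    have hr (x : Fin m) (a : ℕ) : a ≤ r x ↔ a = 0 ∨ ∃ j, P (e j) x ∧ a ≤ p j := by
      rcases Nat.eq_zero_or_pos a with ha | ha
      · simp [ha]
      · simp only [r, Finset.le_sup_iff (show ⊥ < a from ha), ha.ne', false_or, Finset.mem_filter,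
          Finset.mem_univ, true_and]
    -- The deadline is the earliest slot prescribed to an element above `x`, capped by the last slot
    -- `m - 1`.
    have hd' (x : Fin m) : ∃ d, ∀ b, d ≤ b ↔ m ≤ b + 1 ∨ ∃ j, P x (e j) ∧ p j ≤ b := by
      have hex : ∃ b, m ≤ b + 1 ∨ ∃ j, P x (e j) ∧ p j ≤ b := ⟨m, Or.inl (by omega)⟩
      refine ⟨Nat.find hex, fun b => ⟨fun h => ?_, fun h => Nat.find_min' hex h⟩⟩
      rcases Nat.find_spec hex with h' | ⟨j, hj, h'⟩
      · exact Or.inl (by omega)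
      · exact Or.inr ⟨j, hj, h'.trans h⟩
    choose d hd using hd'
    have hrm (x : Fin m) : r x < m := by
      by_contra h
      rcases (hr x m).1 (by omega) with h | ⟨j, -, h⟩
      · omega
      · have := (p j).2
        omega
    have hdm (x : Fin m) : d x < m := by
      have := (hd x (m - 1)).2 (Or.inl (by omega))
      omega
    obtain ⟨pos, hpos, hinj, hmono⟩ := exists_schedule P hP d
      (fun x y hxy => (hd x _).2 (((hd y _).1 le_rfl).imp_right fun ⟨j, hj, h⟩ =>
        ⟨j, hP.trans _ _ _ hxy hj, h⟩)) Finset.univ r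
      (fun x y hxy => (hr y _).2 (((hr x _).1 le_rfl).imp_right fun ⟨j, hj, h⟩ =>
        ⟨j, hP.trans _ _ _ hj hxy, h⟩))
      (fun a b => by
        rcases Nat.lt_or_ge a m with ha | ha
        -- The scheduling lemma asks for all `b`, but no deadline exceeds `m - 1`, so `b` may be cut
        -- off there.
        · refine le_trans (Finset.card_le_card fun x hx => ?_)
            ((H a ha (min b (m - 1)) (by omega)).trans (by omega))
          rw [Finset.mem_filter] at hx ⊢
          refine ⟨hx.1, (hr x a).1 hx.2.1, ?_⟩
          have hx' : d x ≤ min b (m - 1) := le_min hx.2.2 (Nat.le_sub_one_of_lt (hdm x))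
          exact ((hd x _).1 hx').imp_left fun h => by omega
        · rw [Finset.card_eq_zero.2 (Finset.filter_eq_empty_iff.2 fun x _ hx => ?_)]
          · exact Nat.zero_le _
          · have := hrm x
            omega)
    have hinj' : Function.Injective pos := fun x y h => hinj x (by simp) y (by simp) h
    have hpm (x : Fin m) : pos x < m := (hpos x (by simp)).2.trans_lt (hdm x)
    refine ⟨fun x y => pos x ≤ pos y, ?_, fun x y h => hmono x (by simp) y (by simp) h,
      fun j => ?_⟩
    · exact
        { refl := fun x => le_refl (pos x)
          trans := fun x y z h h' => le_trans h h'
          antisymm := fun x y h h' => hinj' (le_antisymm h h')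
          total := fun x y => le_total (pos x) (pos y) }
    · rw [position_of_injective hinj' hpm]
      -- By reflexivity `e j` bounds itself on both sides: it is released no earlier than `p j` and
      -- due no later, which pins its slot.
      have h1 := (hr (e j) (p j)).2 (Or.inr ⟨j, hP.refl _, le_rfl⟩)
      have h2 := (hd (e j) (p j)).2 (Or.inr ⟨j, hP.refl _, le_rfl⟩)
      have := hpos (e j) (by simp)
      omega

end Position

/-! ### Ranks -/

theorem rank_add_ncard (r : PositionalScoringRule) {m n : ℕ} (T : Fin n → Fin m → Fin m → Prop)
    (tie : Fin m → Fin m → Prop) (c : Fin m) :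
    rank r T tie c + {x | ¬resultOrder r T tie x c}.ncard = m := by
  have := Set.ncard_add_ncard_compl {x | resultOrder r T tie x c}
  rw [Nat.card_eq_fintype_card, Fintype.card_fin] at this
  exact this

/-- Rank and number of candidates behind `c` add up to `m`. The minimal rank is attained by a
completion, so a bound on it is a statement about a single completion. -/
theorem minRankBelowReversed_iff (r : PositionalScoringRule) (k : ℕ) (I : RankInstance) :
    MinRankBelowReversed r k I ↔ ∃ T, IsCompletion T I.profile ∧ ∃ d : Fin k → Fin I.m,
      Function.Injective d ∧ ∀ j, totalScore r T (d j) < totalScore r T I.c ∨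
        totalScore r T (d j) = totalScore r T I.c ∧ ¬I.tie (d j) I.c := by
  have hset (T : Fin I.n → Fin I.m → Fin I.m → Prop) (d : Fin I.m) :
      ¬resultOrder r T I.tie d I.c ↔ (totalScore r T d < totalScore r T I.c ∨
        totalScore r T d = totalScore r T I.c ∧ ¬I.tie d I.c) := by
    unfold resultOrder
    rcases lt_trichotomy (totalScore r T d) (totalScore r T I.c) with h | h | h
    · simp [h, h.not_gt, h.ne]
    · simp [h]
    · simp [h, h.not_gt, h.ne']
  simp only [← hset]
  have hmem := minRank_mem r I.profile I.profile_partial I.tie I.c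
  have hcard (T : Fin I.n → Fin I.m → Fin I.m → Prop) :
      (rank r T I.tie I.c : ℤ) < I.m - k + 1 ↔ ∃ d : Fin k → Fin I.m,
        Function.Injective d ∧ ∀ j, ¬resultOrder r T I.tie (d j) I.c := by
    have h1 := rank_add_ncard r T I.tie I.c
    have h2 : (rank r T I.tie I.c : ℤ) < I.m - k + 1 ↔
        k ≤ {x | ¬resultOrder r T I.tie x I.c}.ncard := by omega
    rw [h2]
    constructor
    · intro h
      obtain ⟨S, hS, hSk⟩ := Set.exists_subset_card_eq h
      have hS' : Nat.card S = k := hSk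
      let f := (Finite.equivFinOfCardEq hS').symm
      exact ⟨fun j => (f j).1, Subtype.val_injective.comp f.injective, fun j => hS (f j).2⟩
    · rintro ⟨d, hd, hd'⟩
      have h3 : (Set.range d).ncard = k := by
        rw [← Set.image_univ, Set.ncard_image_of_injective _ hd, Set.ncard_univ]
        simp
      rw [← h3]
      exact Set.ncard_le_ncard (Set.range_subset_iff.2 hd')
  unfold MinRankBelowReversed
  constructor
  · intro h
    obtain ⟨T, hT, hTr⟩ := hmem
    exact ⟨T, hT, (hcard T).1 (by rw [hTr]; exact h)⟩
  · rintro ⟨T, hT, h⟩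
    refine lt_of_le_of_lt ?_ ((hcard T).2 h)
    have : minRank r I.profile I.tie I.c ≤ rank r T I.tie I.c := Nat.sInf_le ⟨T, hT, rfl⟩
    exact_mod_cast this

open Classical in
/-- The number of elements that have to lie in an interval of positions is not too large. -/
def CanPlace {m q : ℕ} (P : Fin m → Fin m → Prop) (e p : Fin q → Fin m) : Prop :=
  ∀ a < m, ∀ b < m, (Finset.univ.filter fun x =>
    (a = 0 ∨ ∃ j, P (e j) x ∧ a ≤ p j) ∧ (b + 1 = m ∨ ∃ j, P x (e j) ∧ p j ≤ b)).card ≤ b + 1 - a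

/-- Only the positions of the `k + 1` chosen candidates enter the scores that are compared, and the
votes can be completed independently of each other; so completions may be replaced by placeable
position tuples. -/
theorem minRankBelowReversed_iff_exists (r : PositionalScoringRule) (k : ℕ) (I : RankInstance) :
    MinRankBelowReversed r k I ↔ ∃ e : Fin (k + 1) → Fin I.m, e 0 = I.c ∧ Function.Injective e ∧
      ∃ p : Fin I.n → Fin (k + 1) → Fin I.m, (∀ i, CanPlace (I.profile i) e (p i)) ∧
        ∀ j, j ≠ 0 →
          (∑ i, r.score I.m (p i j + 1) < ∑ i, r.score I.m (p i 0 + 1) ∨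
            ∑ i, r.score I.m (p i j + 1) = ∑ i, r.score I.m (p i 0 + 1) ∧
              ¬I.tie (e j) (e 0)) := by
  have hm : 0 < I.m := Fin.pos I.c
  rw [minRankBelowReversed_iff]
  constructor
  · rintro ⟨T, hT, d, hd, hscore⟩
    -- By reflexivity of the tiebreaker `c` is not behind itself, so prepending it keeps the tuple
    -- injective.
    have hdc (j : Fin k) : d j ≠ I.c := by
      intro h
      have := hscore j
      rw [h] at this
      rcases this with h | ⟨-, h⟩
      · exact lt_irrefl _ h
      · exact h (I.tie_linear.refl _)
    let e : Fin (k + 1) → Fin I.m := Fin.cons I.c d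
    let p (i : Fin I.n) (j : Fin (k + 1)) : Fin I.m := ⟨position (T i) (e j) - 1, by
      have := position_le (T := T i) (e j)
      omega⟩
    have hp (i : Fin I.n) (j : Fin (k + 1)) : (p i j : ℕ) + 1 = position (T i) (e j) :=
      Nat.sub_add_cancel (position_pos (hT i).1 _)
    refine ⟨e, rfl, Fin.cons_injective_iff.2 ⟨fun ⟨j, hj⟩ => hdc j hj, hd⟩, p, fun i => ?_,
      fun j hj => ?_⟩
    · exact (exists_linearExtension_iff (I.profile_partial i) hm e (p i)).1
        ⟨T i, (hT i).1, (hT i).2, fun j => (hp i j).symm⟩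
    · obtain ⟨j, rfl⟩ := Fin.exists_succ_eq.2 hj
      simp only [hp]
      exact hscore j
  · rintro ⟨e, he, hinj, p, hp, hscore⟩
    choose T hT hPT hpos using fun i =>
      (exists_linearExtension_iff (I.profile_partial i) hm e (p i)).2 (hp i)
    refine ⟨T, fun i => ⟨hT i, hPT i⟩, fun j => e j.succ, hinj.comp (Fin.succ_injective k),
      fun j => ?_⟩
    have := hscore j.succ (Fin.succ_ne_zero j)
    simp only [← hpos, he] at this
    exact this

namespace StackProgram

open Enc

/-! ### Digits and dynamic programming -/

/-- The digits of `x` in base `b`. -/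
def dig (b x j : ℕ) : ℕ := x / b ^ j % b

theorem dig_lt {b : ℕ} (hb : 0 < b) (x j : ℕ) : dig b x j < b := Nat.mod_lt _ hb

theorem exists_dig_eq {b q : ℕ} (v : ℕ → ℕ) (hv : ∀ l < q, v l < b) :
    ∃ x < b ^ q, ∀ l < q, dig b x l = v l := by
  let f : Fin q → Fin b := fun l => ⟨v l, hv l l.2⟩
  refine ⟨finFunctionFinEquiv f, (finFunctionFinEquiv f).2, fun l hl => ?_⟩
  have := finFunctionFinEquiv_symm_apply_val (finFunctionFinEquiv f) ⟨l, hl⟩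
  rw [Equiv.symm_apply_apply] at this
  exact this.symm

/-- The first `q` digits in base `m`. -/
def digs {m : ℕ} (hm : 0 < m) (q x : ℕ) (j : Fin q) : Fin m := ⟨dig m x j, dig_lt hm x j⟩

theorem exists_iff_exists_digs {m : ℕ} (hm : 0 < m) {q : ℕ} {Q : (Fin q → Fin m) → Prop} :
    (∃ e, Q e) ↔ ∃ x < m ^ q, Q (digs hm q x) := by
  refine ⟨fun ⟨e, he⟩ => ?_, fun ⟨x, _, hx⟩ => ⟨_, hx⟩⟩
  obtain ⟨x, hx, hxe⟩ := exists_dig_eq (b := m) (q := q)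
    (fun l => if h : l < q then (e ⟨l, h⟩ : ℕ) else 0) (fun l hl => by
      simp only [hl, dif_pos]
      exact (e ⟨l, hl⟩).2)
  refine ⟨x, hx, ?_⟩
  have : digs hm q x = e := by
    funext j
    apply Fin.ext
    simp [digs, hxe j j.2]
  rwa [this]

/-- The vector coded by `s` is the sum of the weights of `i` admissible choices. -/
def Reach (b q : ℕ) (A : ℕ → ℕ → Prop) (w : ℕ → ℕ → ℕ) (i s : ℕ) : Prop :=
  ∃ p : ℕ → ℕ, (∀ i' < i, A i' (p i')) ∧ ∀ l < q, dig b s l = ∑ i' ∈ Finset.range i, w (p i') l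

theorem reach_zero {b q : ℕ} {A : ℕ → ℕ → Prop} {w : ℕ → ℕ → ℕ} {s : ℕ} :
    Reach b q A w 0 s ↔ ∀ l < q, dig b s l = 0 := by
  simp [Reach]

/-- Weights are nonnegative, so partial sums are bounded by the digits of `s` and hence below `b`.
They are therefore coded by some `s' < b ^ q`, and the search over codes misses nothing. -/
theorem reach_succ {b q : ℕ} (hb : 0 < b) {A : ℕ → ℕ → Prop} {w : ℕ → ℕ → ℕ} {i s : ℕ} :
    Reach b q A w (i + 1) s ↔ ∃ s' < b ^ q, Reach b q A w i s' ∧ ∃ x, A i x ∧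
      ∀ l < q, dig b s l = dig b s' l + w x l := by
  constructor
  · rintro ⟨p, hp, hs⟩
    obtain ⟨s', hs', h⟩ := exists_dig_eq (b := b) (q := q)
      (fun l => ∑ i' ∈ Finset.range i, w (p i') l) (fun l hl => by
        refine lt_of_le_of_lt ?_ (dig_lt hb s l)
        rw [hs l hl, Finset.sum_range_succ]
        exact Nat.le_add_right _ _)
    refine ⟨s', hs', ⟨p, fun i' hi' => hp i' (by omega), h⟩, p i, hp i (by omega), fun l hl => ?_⟩
    rw [hs l hl, h l hl, Finset.sum_range_succ]
  · rintro ⟨s', -, ⟨p, hp, hs'⟩, x, hx, h⟩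
    have hne (i' : ℕ) (hi' : i' < i) : Function.update p i x i' = p i' :=
      Function.update_of_ne hi'.ne _ _
    refine ⟨Function.update p i x, fun i' hi' => ?_, fun l hl => ?_⟩
    · rcases Nat.lt_succ_iff_lt_or_eq.1 hi' with h' | rfl
      · rw [hne _ h']
        exact hp i' h'
      · rw [Function.update_self]
        exact hx
    · rw [h l hl, hs' l hl, Finset.sum_range_succ, Function.update_self]
      congr 1
      exact Finset.sum_congr rfl fun i' hi' => by rw [hne _ (Finset.mem_range.1 hi')]

/-! ### Reading an instance -/

theorem length_flatMap_const {α β : Type} (l : List α) (f : α → List β) (L : ℕ)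
    (h : ∀ x, (f x).length = L) : (l.flatMap f).length = l.length * L := by
  simp [h]

theorem getElem?_flatMap_const {α β : Type} (l : List α) (f : α → List β) (L : ℕ)
    (h : ∀ x, (f x).length = L) (i : ℕ) (hi : i < l.length) (j : ℕ) (hj : j < L) :
    (l.flatMap f)[i * L + j]? = (f l[i])[j]? := by
  induction l generalizing i with
  | nil => simp at hi
  | cons a l ih =>
    rw [List.flatMap_cons]
    cases i with
    | zero =>
      rw [Nat.zero_mul, Nat.zero_add, List.getElem?_append_left (by rw [h]; exact hj)]
      rfl
    | succ i =>
      rw [List.getElem?_append_right (by rw [h]; nlinarith), h,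
        show (i + 1) * L + j - L = i * L + j by rw [Nat.succ_mul]; omega]
      exact ih i (by simpa using hi)

theorem length_encodeRel {m : ℕ} (R : Fin m → Fin m → Prop) :
    (encodeRel R).length = m * (m + 1) + 2 := by
  unfold encodeRel
  rw [List.length_append, List.length_cons, length_flatMap_const _ _ (m + 1) (by simp)]
  simp

open Classical in
theorem getElem?_encodeRel {m : ℕ} (R : Fin m → Fin m → Prop) (x y : Fin m) :
    (encodeRel R)[x * (m + 1) + y + 1]? = some (.bit (decide (R x y))) := by
  unfold encodeRel
  have hlt : (x : ℕ) * (m + 1) + y < m * (m + 1) := by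
    have := x.2
    have := y.2
    nlinarith
  rw [List.getElem?_append_left (by
    rw [List.length_cons, length_flatMap_const _ _ (m + 1) (by simp)]
    simpa using hlt), List.getElem?_cons_succ,
    getElem?_flatMap_const _ _ (m + 1) (by simp) x (by simp) y (by omega),
    List.getElem?_append_left (by simp)]
  simp

end StackProgram

open StackProgram

namespace RankInstance

variable (I : RankInstance)

theorem m_pos : 0 < I.m := Fin.pos I.c

theorem length_encode : I.encode.length = I.m + 1 + (I.n + 1) * (I.m * (I.m + 1) + 2) := by
  unfold encode
  rw [List.length_append, List.length_append, length_encodeRel,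
    length_flatMap_const _ _ _ fun i => length_encodeRel (I.profile i)]
  simp
  ring

theorem getElem?_encode_c (x : Fin I.m) : I.encode[(x : ℕ)]? = some (.bit (decide (x = I.c))) := by
  unfold encode
  rw [List.getElem?_append_left (by simp; omega), List.getElem?_append_left (by simp),
    List.getElem?_append_left (by simp)]
  simp

theorem getElem?_encode_m : I.encode[I.m]? = some .comma := by
  unfold encode
  rw [List.getElem?_append_left (by simp), List.getElem?_append_left (by simp),
    List.getElem?_append_right (by simp)]
  simp

open Classical in
theorem getElem?_encode_tie (x y : Fin I.m) :
    I.encode[I.m + 1 + (x * (I.m + 1) + y + 1)]? = some (.bit (decide (I.tie x y))) := by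
  have hlt : (x : ℕ) * (I.m + 1) + y < I.m * (I.m + 1) := by
    have := x.2
    have := y.2
    nlinarith
  unfold encode
  rw [List.getElem?_append_left (by simp [length_encodeRel]; omega),
    List.getElem?_append_right (by simp)]
  simp only [List.length_append, List.length_map, List.length_finRange, List.length_singleton,
    Nat.add_sub_cancel_left]
  exact getElem?_encodeRel _ x y

open Classical in
theorem getElem?_encode_profile (i : Fin I.n) (x y : Fin I.m) :
    I.encode[I.m + 1 + ((i + 1) * (I.m * (I.m + 1) + 2) + (x * (I.m + 1) + y + 1))]? =
      some (.bit (decide (I.profile i x y))) := by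
  have hlt : (x : ℕ) * (I.m + 1) + y < I.m * (I.m + 1) := by
    have := x.2
    have := y.2
    nlinarith
  unfold encode
  have hi := Nat.add_one_mul (i : ℕ) (I.m * (I.m + 1) + 2)
  rw [List.getElem?_append_right (by simp [length_encodeRel]; omega)]
  simp only [List.length_append, List.length_map, List.length_finRange, List.length_singleton,
    length_encodeRel]
  rw [show I.m + 1 + ((i + 1) * (I.m * (I.m + 1) + 2) + (x * (I.m + 1) + y + 1)) -
    (I.m + 1 + (I.m * (I.m + 1) + 2)) = i * (I.m * (I.m + 1) + 2) + (x * (I.m + 1) + y + 1) by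
      rw [Nat.succ_mul]; omega,
    getElem?_flatMap_const _ _ _ (fun i => length_encodeRel (I.profile i)) i (by simp) _ (by omega)]
  simpa using getElem?_encodeRel (I.profile i) x y

/-- The distinguished candidate, as a predicate on numbers. -/
def IsCand (x : ℕ) : Prop := x = I.c

/-- The tiebreaker, as a relation on numbers. -/
def Tie (x y : ℕ) : Prop := ∃ (hx : x < I.m) (hy : y < I.m), I.tie ⟨x, hx⟩ ⟨y, hy⟩

/-- The profile, as relations on numbers. -/
def Pref (i x y : ℕ) : Prop :=
  ∃ (hi : i < I.n) (hx : x < I.m) (hy : y < I.m), I.profile ⟨i, hi⟩ ⟨x, hx⟩ ⟨y, hy⟩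

end RankInstance

namespace StackProgram

open Enc

noncomputable instance : Enc RankInstance := ⟨1, fun I _ => I.encode⟩

variable {α β : Type} [Enc α] [Enc β] {M : FinTM2} {I : α → RankInstance}

/-- A function used in a context with an additional variable. -/
theorem PT.up {f : α → β} (hf : PT M f) {γ : Type} [Enc γ] : PT M fun x : α × γ => f x.1 :=
  hf.comp PT.fst

theorem PT.encode (hI : PT M I) : PT M fun a => (I a).encode := hI.recode rfl fun _ _ _ => rfl

/-- The indicator vector ends at the first comma of the input, so `m` is the number of places before
it. -/
theorem PT.m (hI : PT M I) : PT M fun a => (I a).m := by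
  classical
  refine (PT.card (R := fun a x => ∀ y < x + 1, ¬(I a).encode[y]? = some .comma)
    (PD.ball (PD.getElem hI.encode.up.up PT.snd _).not PT.snd.succ)
    (PT.length.comp hI.encode)).recode rfl fun a _ _ => ?_
  congr 1
  refine (Finset.card_range _).symm.trans (congrArg Finset.card ?_)
  ext x
  simp only [Finset.mem_filter, Finset.mem_range]
  constructor
  · intro hx
    refine ⟨?_, fun y hy h => ?_⟩
    · rw [RankInstance.length_encode]
      omega
    · have := (I a).getElem?_encode_c ⟨y, by omega⟩
      simp only [h] at this
      cases this
  · rintro ⟨-, hx⟩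
    by_contra h
    exact hx (I a).m (by omega) (I a).getElem?_encode_m

/-- All relations have tables of the same length, so the number of voters follows from the length of
the input; the predecessor discounts the tiebreaker. -/
theorem PT.n (hI : PT M I) : PT M fun a => (I a).n := by
  have hm := hI.m
  refine (((PT.length.comp hI.encode).sub hm.succ).div
    ((hm.mul hm.succ).add (PT.const 2))).pred.recode rfl fun a _ _ => ?_
  rw [RankInstance.length_encode, Nat.add_sub_cancel_left, Nat.mul_div_cancel _ (by omega),
    Nat.add_sub_cancel]

variable {i x y : α → ℕ}

theorem PD.isCand (hI : PT M I) (hx : PT M x) : PD M fun a => (I a).IsCand (x a) := by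
  refine ((PD.lt hx hI.m).and (PD.getElem hI.encode hx (.bit true))).congr fun a => ?_
  constructor
  · intro h
    have h : x a = (I a).c := h
    rw [h, RankInstance.getElem?_encode_c]
    simp
  · rintro ⟨h1, h2⟩
    have h3 := (I a).getElem?_encode_c ⟨x a, h1⟩
    rw [h2] at h3
    simp only [Option.some.injEq, Γ'.bit.injEq, true_eq_decide_iff] at h3
    exact congrArg Fin.val h3

theorem PD.tie (hI : PT M I) (hx : PT M x) (hy : PT M y) :
    PD M fun a => (I a).Tie (x a) (y a) := by
  refine ((PD.lt hx hI.m).and ((PD.lt hy hI.m).and (PD.getElem hI.encode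
    (hI.m.succ.add ((hx.mul hI.m.succ).add hy).succ) (.bit true)))).congr fun a => ?_
  constructor
  · rintro ⟨h1, h2, h⟩
    refine ⟨h1, h2, ((I a).getElem?_encode_tie ⟨x a, h1⟩ ⟨y a, h2⟩).trans ?_⟩
    simp [h]
  · rintro ⟨h1, h2, h⟩
    refine ⟨h1, h2, ?_⟩
    have h3 := (I a).getElem?_encode_tie ⟨x a, h1⟩ ⟨y a, h2⟩
    simp only [h] at h3
    simpa using h3

theorem PD.pref (hI : PT M I) (hi : PT M i) (hx : PT M x) (hy : PT M y) :
    PD M fun a => (I a).Pref (i a) (x a) (y a) := by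
  refine ((PD.lt hi hI.n).and ((PD.lt hx hI.m).and ((PD.lt hy hI.m).and (PD.getElem hI.encode
    (hI.m.succ.add ((hi.succ.mul ((hI.m.mul hI.m.succ).add (PT.const 2))).add
      ((hx.mul hI.m.succ).add hy).succ)) (.bit true))))).congr fun a => ?_
  constructor
  · rintro ⟨h0, h1, h2, h⟩
    refine ⟨h0, h1, h2,
      ((I a).getElem?_encode_profile ⟨i a, h0⟩ ⟨x a, h1⟩ ⟨y a, h2⟩).trans ?_⟩
    simp [h]
  · rintro ⟨h0, h1, h2, h⟩
    refine ⟨h0, h1, h2, ?_⟩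
    have h3 := (I a).getElem?_encode_profile ⟨i a, h0⟩ ⟨x a, h1⟩ ⟨y a, h2⟩
    simp only [h] at h3
    simpa using h3

end StackProgram

namespace StackProgram

open Enc

/-! ### The decision procedure -/

open Classical in
/-- The scores, extended by zero. -/
noncomputable def sc (r : PositionalScoringRule) (m j : ℕ) : ℕ :=
  if 1 ≤ j ∧ j ≤ m then r.score m j else 0

theorem sc_add_one (r : PositionalScoringRule) {m : ℕ} (x : Fin m) :
    sc r m (x + 1) = r.score m (x + 1) :=
  if_pos ⟨by omega, x.2⟩

/-- The element `z` has to be placed between the positions `a` and `b`. -/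
def Confined (I : RankInstance) (q i e x a b z : ℕ) : Prop :=
  (a = 0 ∨ ∃ j < q, I.Pref i (dig I.m e j) z ∧ a ≤ dig I.m x j) ∧
    (b + 1 = I.m ∨ ∃ j < q, I.Pref i z (dig I.m e j) ∧ dig I.m x j ≤ b)

open Classical in
/-- Voter `i` can give the candidates coded by `e` the positions coded by `x`. -/
def Placeable (I : RankInstance) (q e i x : ℕ) : Prop :=
  x < I.m ^ q ∧ ∀ a < I.m, ∀ b < I.m,
    ((Finset.range I.m).filter (Confined I q i e x a b)).card ≤ b + 1 - a

/-- A bound for the total scores. -/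
noncomputable def scoreBase (r : PositionalScoringRule) (I : RankInstance) : ℕ :=
  I.n * sc r I.m 1 + 1

/-- The vector of total scores coded by `s` is attained by the candidates coded by `e` in the
completions of the votes of the first `i` voters. -/
def Attains (r : PositionalScoringRule) (q : ℕ) (I : RankInstance) (e i s : ℕ) : Prop :=
  Reach (scoreBase r I) q (Placeable I q e) (fun x l => sc r I.m (dig I.m x l + 1)) i s

/-- The candidates coded by `e` are distinct, and in some completion the first of them is the
distinguished one and beats the others. -/
def Accepts (r : PositionalScoringRule) (q : ℕ) (I : RankInstance) (e : ℕ) : Prop :=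
  I.IsCand (dig I.m e 0) ∧ (∀ j < q, ∀ j' < q, dig I.m e j = dig I.m e j' → j = j') ∧
    ∃ s < scoreBase r I ^ q, Attains r q I e I.n s ∧
      ∀ j < q, j = 0 ∨ (dig (scoreBase r I) s j < dig (scoreBase r I) s 0 ∨
        dig (scoreBase r I) s j = dig (scoreBase r I) s 0 ∧
          ¬I.Tie (dig I.m e j) (dig I.m e 0))

theorem pref_digs (I : RankInstance) (i : Fin I.n) (x y : Fin I.m) :
    I.Pref i x y ↔ I.profile i x y :=
  ⟨fun ⟨_, _, _, h⟩ => h, fun h => ⟨i.2, x.2, y.2, h⟩⟩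

theorem placeable_iff (I : RankInstance) (q e x : ℕ) (i : Fin I.n) (hx : x < I.m ^ q) :
    Placeable I q e i x ↔ CanPlace (I.profile i) (digs I.m_pos q e) (digs I.m_pos q x) := by
  classical
  unfold Placeable CanPlace
  simp only [hx, true_and]
  refine forall₂_congr fun a ha => forall₂_congr fun b hb => ?_
  rw [← Finset.card_map Fin.valEmbedding]
  refine iff_of_eq (congrArg (· ≤ b + 1 - a) (congrArg Finset.card ?_))
  ext z
  simp only [Finset.mem_filter, Finset.mem_range, Finset.mem_map, Finset.mem_univ, true_and,
    Fin.valEmbedding_apply]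
  have key (z : Fin I.m) : Confined I q i e x a b z ↔
      (a = 0 ∨ ∃ j, I.profile i (digs I.m_pos q e j) z ∧ a ≤ digs I.m_pos q x j) ∧
        (b + 1 = I.m ∨ ∃ j, I.profile i z (digs I.m_pos q e j) ∧ digs I.m_pos q x j ≤ b) := by
    unfold Confined
    simp only [← pref_digs]
    refine and_congr (or_congr Iff.rfl ?_) (or_congr Iff.rfl ?_)
    · exact ⟨fun ⟨j, hj, h⟩ => ⟨⟨j, hj⟩, h⟩, fun ⟨j, h⟩ => ⟨j, j.2, h⟩⟩
    · exact ⟨fun ⟨j, hj, h⟩ => ⟨⟨j, hj⟩, h⟩, fun ⟨j, h⟩ => ⟨j, j.2, h⟩⟩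
  constructor
  · rintro ⟨hz, h⟩
    exact ⟨⟨z, hz⟩, (key ⟨z, hz⟩).1 h, rfl⟩
  · rintro ⟨z, h, rfl⟩
    exact ⟨z.2, (key z).2 h⟩

/-- Candidate tuples, position tuples and score vectors become numbers through their digits, so that
all quantifiers are bounded by polynomials in the input length. -/
theorem minRankBelowReversed_iff_accepts (r : PositionalScoringRule) (k : ℕ) (I : RankInstance) :
    MinRankBelowReversed r k I ↔ ∃ e < I.m ^ (k + 1), Accepts r (k + 1) I e := by
  have hm := I.m_pos
  rw [minRankBelowReversed_iff_exists, exists_iff_exists_digs hm]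
  refine exists_congr fun e => and_congr_right fun _ => and_congr Fin.ext_iff (and_congr ?_ ?_)
  · constructor
    · intro h j hj j' hj' hjj'
      exact congrArg Fin.val (@h ⟨j, hj⟩ ⟨j', hj'⟩ (Fin.ext hjj'))
    · intro h j j' hjj'
      exact Fin.ext (h j j.2 j' j'.2 (congrArg Fin.val hjj'))
  have htie (j : Fin (k + 1)) : I.Tie (dig I.m e j) (dig I.m e 0) ↔
      I.tie (digs hm (k + 1) e j) (digs hm (k + 1) e 0) :=
    ⟨fun ⟨_, _, h⟩ => h, fun h => ⟨dig_lt hm _ _, dig_lt hm _ _, h⟩⟩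
  constructor
  · rintro ⟨p, hp, hscore⟩
    have hcode (i : Fin I.n) : ∃ x < I.m ^ (k + 1), digs hm (k + 1) x = p i :=
      (exists_iff_exists_digs hm (Q := fun v => v = p i)).1 ⟨p i, rfl⟩
    choose x hx hxp using hcode
    let x' (i : ℕ) : ℕ := if h : i < I.n then x ⟨i, h⟩ else 0
    have hsum (l : Fin (k + 1)) : ∑ i ∈ Finset.range I.n, sc r I.m (dig I.m (x' i) l + 1) =
        ∑ i, r.score I.m (p i l + 1) := by
      rw [Finset.sum_range]
      refine Finset.sum_congr rfl fun i _ => ?_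
      have : dig I.m (x' i) l = p i l := by
        rw [← hxp i]
        simp [x', digs]
      rw [this, sc_add_one]
    -- A total score has `n` summands, each at most the top score, so it is a digit in base
    -- `scoreBase r I`.
    obtain ⟨s, hs, hsv⟩ := exists_dig_eq (b := scoreBase r I) (q := k + 1)
      (fun l => ∑ i ∈ Finset.range I.n, sc r I.m (dig I.m (x' i) l + 1)) (fun l hl => by
        rw [hsum ⟨l, hl⟩]
        refine Nat.lt_succ_of_le ((Finset.sum_le_card_nsmul _ _ (sc r I.m 1) fun i _ => ?_).trans
          (by simp))
        have := sc_add_one r (⟨0, hm⟩ : Fin I.m)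
        rw [Nat.zero_add] at this
        rw [this]
        exact r.antitone _ _ _ le_rfl (Nat.le_add_left _ _) (p i ⟨l, hl⟩).2)
    refine ⟨s, hs, ⟨x', fun i hi => ?_, hsv⟩, fun j hj => ?_⟩
    · have : x' i = x ⟨i, hi⟩ := dif_pos hi
      rw [this]
      refine (placeable_iff I _ e _ ⟨i, hi⟩ (hx _)).2 ?_
      rw [hxp]
      exact hp _
    · rcases Nat.eq_zero_or_pos j with h | h
      · exact Or.inl h
      · right
        have hsum0 := hsum 0
        rw [Fin.val_zero] at hsum0
        rw [hsv j hj, hsv 0 (by omega), htie ⟨j, hj⟩, hsum ⟨j, hj⟩, hsum0]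
        exact hscore ⟨j, hj⟩ fun h' => h.ne' (congrArg Fin.val h')
  · rintro ⟨s, hs, ⟨x, hx, hsx⟩, hscore⟩
    have hsum (l : Fin (k + 1)) : dig (scoreBase r I) s l =
        ∑ i : Fin I.n, r.score I.m (digs hm (k + 1) (x i) l + 1) := by
      rw [hsx l l.2, Finset.sum_range]
      exact Finset.sum_congr rfl fun i _ => sc_add_one r (digs hm (k + 1) (x i) l)
    refine ⟨fun i => digs hm (k + 1) (x i), fun i => ?_, fun j hj => ?_⟩
    · exact (placeable_iff I _ e _ i (hx i i.2).1).1 (hx i i.2)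
    · rw [← htie, ← hsum, ← hsum]
      exact (hscore j j.2).resolve_left fun h => hj (Fin.ext h)

/-- The recursion for `Attains`, with the pair of `i` and `s` coded by `j` and the previous values
in `L`. -/
def AttainsStep (r : PositionalScoringRule) (q : ℕ) (I : RankInstance) (e j : ℕ) (L : List Γ') :
    Prop :=
  (j / scoreBase r I ^ q = 0 ∧ ∀ l < q, dig (scoreBase r I) (j % scoreBase r I ^ q) l = 0) ∨
    (0 < j / scoreBase r I ^ q ∧ ∃ s < scoreBase r I ^ q,
      L[j - 1 - ((j / scoreBase r I ^ q - 1) * scoreBase r I ^ q + s)]? = some (.bit true) ∧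
      ∃ x < I.m ^ q, Placeable I q e (j / scoreBase r I ^ q - 1) x ∧
        ∀ l < q, dig (scoreBase r I) (j % scoreBase r I ^ q) l =
          dig (scoreBase r I) s l + sc r I.m (dig I.m x l + 1))

/-- With `W = scoreBase r I ^ q`, the table entry for `i` voters and score vector `s < W` has the
index `i * W + s`. It depends only on entries for `i - 1` voters, whose indices are below `i * W`,
so they are already in the list. -/
theorem attains_iff (r : PositionalScoringRule) (q : ℕ) (I : RankInstance) (e j : ℕ) :
    Attains r q I e (j / scoreBase r I ^ q) (j % scoreBase r I ^ q) ↔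
      AttainsStep r q I e j (prevBits (fun t => Attains r q I e (t / scoreBase r I ^ q)
        (t % scoreBase r I ^ q)) j) := by
  unfold AttainsStep
  have hb : 0 < scoreBase r I := Nat.succ_pos _
  generalize hW : scoreBase r I ^ q = W
  have hWpos : 0 < W := hW ▸ Nat.pow_pos hb
  rcases Nat.eq_zero_or_pos (j / W) with h | h
  · rw [h]
    simp only [true_and, lt_irrefl, false_and, or_false]
    exact reach_zero
  · obtain ⟨i, hi⟩ := Nat.exists_eq_succ_of_ne_zero h.ne'
    simp only [h, h.ne', true_and, false_and, false_or]
    rw [hi, Nat.succ_eq_add_one, Nat.add_sub_cancel]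
    refine (reach_succ hb).trans ?_
    rw [hW]
    refine exists_congr fun s => and_congr_right fun hs => and_congr ?_ ?_
    · rw [getElem_prevBits]
      · rw [Nat.mul_comm, Nat.mul_add_div hWpos, Nat.div_eq_of_lt hs, Nat.mul_add_mod,
          Nat.mod_eq_of_lt hs]
        rfl
      · have h1 := Nat.div_add_mod j W
        rw [hi, Nat.succ_eq_add_one, Nat.mul_add, Nat.mul_comm W i] at h1
        omega
    · exact exists_congr fun x => ⟨fun ⟨h, h'⟩ => ⟨h.1, h, h'⟩, fun ⟨_, h, h'⟩ => ⟨h, h'⟩⟩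

variable {α : Type} [Enc α] {M : FinTM2} {I : α → RankInstance} {e i x j b s : α → ℕ}

theorem PT.dig (hb : PT M b) (hx : PT M x) (hj : PT M j) :
    PT M fun a => dig (b a) (x a) (j a) := hx.digit hb hj

theorem PD.placeable (q : ℕ) (hI : PT M I) (he : PT M e) (hi : PT M i) (hx : PT M x) :
    PD M fun a => Placeable (I a) q (e a) (i a) (x a) := by
  refine (PD.lt hx (hI.m.pow q)).and (PD.ball (PD.ball (PD.le (PT.card ?_ hI.m.up.up)
    (PT.snd.succ.sub PT.snd.up)) hI.m.up) hI.m)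
  have hm := hI.m.up (γ := ℕ) |>.up (γ := ℕ) |>.up (γ := ℕ)
  have he' := he.up (γ := ℕ) |>.up (γ := ℕ) |>.up (γ := ℕ) |>.up (γ := ℕ)
  have hx' := hx.up (γ := ℕ) |>.up (γ := ℕ) |>.up (γ := ℕ) |>.up (γ := ℕ)
  have hI' := hI.up (γ := ℕ) |>.up (γ := ℕ) |>.up (γ := ℕ) |>.up (γ := ℕ)
  have hi' := hi.up (γ := ℕ) |>.up (γ := ℕ) |>.up (γ := ℕ) |>.up (γ := ℕ)
  exact ((PD.eq PT.snd.up.up (PT.const 0)).or (PD.bex ((PD.pref hI' hi'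
      (PT.dig hm.up he' PT.snd) PT.snd.up).and (PD.le PT.snd.up.up.up (PT.dig hm.up hx' PT.snd)))
      (PT.const q))).and
    ((PD.eq PT.snd.up.succ hm).or (PD.bex ((PD.pref hI' hi' PT.snd.up
      (PT.dig hm.up he' PT.snd)).and (PD.le (PT.dig hm.up hx' PT.snd) PT.snd.up.up))
      (PT.const q)))

end StackProgram

/-! ### The decision procedure runs in polynomial time -/

namespace PositionalScoringRule

open StackProgram Enc

variable {r : PositionalScoringRule}

/-- The machine is called only after the test `1 ≤ j ≤ m`. Polynomial scores make the unary result
small enough. -/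
theorem pt_sc (h : TM2ComputableInPolyTime (fun q : {q : ℕ × ℕ // 1 ≤ q.2 ∧ q.2 ≤ q.1} =>
      (encodingProd unaryEncodingNat unaryEncodingNat).encode q.1) encodeNat
        (fun q => r.score q.1.1 q.1.2)) (hpoly : r.HasPolynomialScores)
    {α : Type} [Enc α] {m j : α → ℕ} (hm : PT h.tm m) (hj : PT h.tm j) :
    PT h.tm fun a => sc r (m a) (j a) := by
  obtain ⟨p, hp⟩ := hpoly
  have hcall := PT.call h p fun q => (hp q.1.1 q.1.2 q.2.1 q.2.2).trans (eval_mono p (by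
    change _ ≤ size q.1
    simp))
  let R (q : ℕ × ℕ) : Prop := 1 ≤ q.2 ∧ q.2 ≤ q.1
  have hc : PD h.tm R := (PD.le (PT.const 1) PT.snd).and (PD.le PT.snd PT.fst)
  have hf : PT h.tm fun q : {q // @decide (R q) (Classical.propDecidable _) = true} =>
      r.score q.1.1 q.1.2 :=
    PT.precode hcall (fun q : {q // @decide (R q) (Classical.propDecidable _) = true} =>
      ⟨q.1, @of_decide_eq_true _ (Classical.propDecidable _) q.2⟩) rfl fun _ _ _ => rfl
  have hbase : PT h.tm fun q : ℕ × ℕ => sc r q.1 q.2 :=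
    PT.dite hc hf (PT.const 0)
      (fun q => if_pos (@of_decide_eq_true _ (Classical.propDecidable _) q.2))
      (fun q => if_neg (@of_decide_eq_false _ (Classical.propDecidable _) q.2))
  exact hbase.comp (hm.pair hj)

theorem pt_scoreBase (h : TM2ComputableInPolyTime (fun q : {q : ℕ × ℕ // 1 ≤ q.2 ∧ q.2 ≤ q.1} =>
      (encodingProd unaryEncodingNat unaryEncodingNat).encode q.1) encodeNat
        (fun q => r.score q.1.1 q.1.2)) (hpoly : r.HasPolynomialScores)
    {α : Type} [Enc α] {I : α → RankInstance} (hI : PT h.tm I) :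
    PT h.tm fun a => scoreBase r (I a) :=
  (hI.n.mul (pt_sc h hpoly hI.m (PT.const 1))).succ

theorem pd_attains (h : TM2ComputableInPolyTime (fun q : {q : ℕ × ℕ // 1 ≤ q.2 ∧ q.2 ≤ q.1} =>
      (encodingProd unaryEncodingNat unaryEncodingNat).encode q.1) encodeNat
        (fun q => r.score q.1.1 q.1.2)) (hpoly : r.HasPolynomialScores)
    (q : ℕ) : PD h.tm fun x : (RankInstance × ℕ) × ℕ =>
      Attains r q x.1.1 x.1.2 (x.2 / scoreBase r x.1.1 ^ q) (x.2 % scoreBase r x.1.1 ^ q) := by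
  have hI : PT h.tm fun x : ((RankInstance × ℕ) × ℕ) × List Γ' => x.1.1.1 :=
    PT.fst.comp (PT.fst.comp PT.fst)
  have he : PT h.tm fun x : ((RankInstance × ℕ) × ℕ) × List Γ' => x.1.1.2 :=
    PT.snd.comp (PT.fst.comp PT.fst)
  have hj : PT h.tm fun x : ((RankInstance × ℕ) × ℕ) × List Γ' => x.1.2 := PT.snd.comp PT.fst
  have hb := pt_scoreBase h hpoly hI
  have hW := hb.pow q
  have hdiv := hj.div hW
  have hmod := hj.mod hW
  refine PD.strongRec
    (R := fun (y : RankInstance × ℕ) j => Attains r q y.1 y.2 (j / scoreBase r y.1 ^ q) (j % scoreBase r y.1 ^ q))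
    (G := fun (x : ((RankInstance × ℕ) × ℕ) × List Γ') => AttainsStep r q x.1.1.1 x.1.1.2 x.1.2 x.2) ?_
    fun y j => attains_iff r q y.1 y.2 j
  unfold AttainsStep
  refine PD.or ((PD.eq hdiv (PT.const 0)).and
    (PD.ball (PD.eq (PT.dig hb.up hmod.up PT.snd) (PT.const 0)) (PT.const q))) ?_
  refine (PD.lt (PT.const 0) hdiv).and (PD.bex (PD.and (PD.getElem PT.snd.up
    (hj.pred.up.sub ((hdiv.pred.mul hW).up.add PT.snd)) (.bit true)) ?_) hW)
  refine PD.bex (PD.and (PD.placeable q hI.up.up he.up.up hdiv.pred.up.up PT.snd) ?_)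
    (hI.m.pow q).up
  exact PD.ball (PD.eq (PT.dig hb.up.up.up hmod.up.up.up PT.snd)
    ((PT.dig hb.up.up.up PT.snd.up.up PT.snd).add (pt_sc h hpoly hI.m.up.up.up
      (PT.dig hI.m.up.up.up PT.snd.up PT.snd).succ))) (PT.const q)

theorem pd_accepts (h : TM2ComputableInPolyTime (fun q : {q : ℕ × ℕ // 1 ≤ q.2 ∧ q.2 ≤ q.1} =>
      (encodingProd unaryEncodingNat unaryEncodingNat).encode q.1) encodeNat
        (fun q => r.score q.1.1 q.1.2)) (hpoly : r.HasPolynomialScores)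
    (q : ℕ) {α : Type} [Enc α] {I : α → RankInstance} {e : α → ℕ} (hI : PT h.tm I)
    (he : PT h.tm e) : PD h.tm fun a => Accepts r q (I a) (e a) := by
  have hb := pt_scoreBase h hpoly hI
  have hW := hb.pow q
  have hd : PT h.tm fun a => dig (I a).m (e a) 0 := PT.dig hI.m he (PT.const 0)
  have hs := (PT.snd (α := α) (β := ℕ) (M := h.tm))
  refine (PD.isCand hI hd).and (PD.and (PD.ball (PD.ball (PD.imp
    (PD.eq (PT.dig hI.m.up.up he.up.up PT.snd.up) (PT.dig hI.m.up.up he.up.up PT.snd))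
    (PD.eq PT.snd.up PT.snd)) (PT.const q)) (PT.const q)) ?_)
  -- The table is read at the index `n * W + s`, with `W` the number of score vectors; for `s < W`,
  -- quotient and remainder give back `n` and `s`.
  refine PD.congr (PD.bex (R := fun a s => Attains r q (I a) (e a)
      (((I a).n * scoreBase r (I a) ^ q + s) / scoreBase r (I a) ^ q)
      (((I a).n * scoreBase r (I a) ^ q + s) % scoreBase r (I a) ^ q) ∧ ∀ j < q, j = 0 ∨
        (dig (scoreBase r (I a)) s j < dig (scoreBase r (I a)) s 0 ∨
          dig (scoreBase r (I a)) s j = dig (scoreBase r (I a)) s 0 ∧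
            ¬(I a).Tie (dig (I a).m (e a) j) (dig (I a).m (e a) 0)))
    (PD.and ((pd_attains h hpoly q).comp (f := fun x : α × ℕ => ((I x.1, e x.1),
      (I x.1).n * scoreBase r (I x.1) ^ q + x.2))
        ((hI.up.pair he.up).pair ((hI.n.mul hW).up.add hs)))
    (PD.ball ((PD.eq PT.snd (PT.const 0)).or (PD.or
      (PD.lt (PT.dig hb.up.up hs.up PT.snd) (PT.dig hb.up.up hs.up (PT.const 0)))
      (PD.and (PD.eq (PT.dig hb.up.up hs.up PT.snd) (PT.dig hb.up.up hs.up (PT.const 0)))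
        (PD.tie hI.up.up (PT.dig hI.m.up.up he.up.up PT.snd) hd.up.up).not)))
      (PT.const q))) hW) fun a => ?_
  refine exists_congr fun s => and_congr_right fun hs => ?_
  rw [Nat.mul_comm, Nat.mul_add_div (by omega), Nat.div_eq_of_lt hs, Nat.mul_add_mod,
    Nat.mod_eq_of_lt hs, Nat.add_zero]

end PositionalScoringRule

open StackProgram

theorem mainTheorem8 (r : PositionalScoringRule) (hcomp : r.ComputableInPolyTime)
    (hpoly : r.HasPolynomialScores) (k : ℕ) (hk : 1 ≤ k) :
    SolvableInPolyTime RankInstance.encode (MinRankBelowReversed r k) := by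
  obtain ⟨h⟩ := hcomp
  have hd : PD h.tm fun I : RankInstance => MinRankBelowReversed r k I :=
    (PD.bex (R := fun I e => Accepts r (k + 1) I e)
      (PositionalScoringRule.pd_accepts h hpoly (k + 1) PT.fst PT.snd) (PT.id.m.pow (k + 1))).congr
      (minRankBelowReversed_iff_accepts r k)
  -- The score machine writes binary digits, so its output alphabet is the one that a Boolean answer
  -- requires.
  exact PT.solvable hd rfl h.outputAlphabet
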